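/- For a permutation $\sigma=\sigma(1)\cdots\sigma(n)$ of $[n]=\{1,\dots,n\}$ let $\mathsf{exc}\,\sigma=\#\{i:\sigma(i)>i\}$, $\mathsf{wex}\,\sigma=\#\{i:\sigma(i)\ge i\}$, $\mathsf{fix}\,\sigma=\#\{i:\sigma(i)=i\}$, let $\mathsf{inv}\,\sigma$ be the number of inversions, $\mathsf{des}\,\sigma$ and $\mathsf{asc}\,\sigma$ the numbers of $i\in[n-1]$ with $\sigma(i)>\sigma(i+1)$, respectively $\sigma(i)<\sigma(i+1)$, and $\mathsf{cda}\,\sigma=\#\{x\in[n]:\sigma^{-1}(x)<x<\sigma(x)\}$. Let $\mathsf{ldd}\,\sigma$ be the number of $i\in[n]$ with $\sigma(i-1)>\sigma(i)>\sigma(i+1)$ under the convention $\sigma(0)=0$, $\sigma(n+1)=\infty$, and $\mathsf{rda}\,\sigma$ the number of $i\in[n]$ with $\sigma(i-1)<\sigma(i)<\sigma(i+1)$ under the convention $\sigma(0)=\infty$, $\sigma(n+1)=0$. Put \begin{align*} (31\text{-}2)\,\sigma&=\#\{(i,j): i+1<j\le n,\ \sigma(i+1)<\sigma(j)<\sigma(i)\},\\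 (2\text{-}31)\,\sigma&=\#\{(i,j): j<i<n,\ \sigma(i+1)<\sigma(j)<\sigma(i)\},\\ (2\text{-}13)\,\sigma&=\#\{(i,j): j<i<n,\ \sigma(i)<\sigma(j)<\sigma(i+1)\},\\ (13\text{-}2)\,\sigma&=\#\{(i,j): i+1<j\le n,\ \sigma(i)<\sigma(j)<\sigma(i+1)\}. \end{align*} For a pattern $\tau$ of length $3$ let $\mathfrak S_n(\tau)$ be the set of permutations of $[n]$ that avoid $\tau$ (no $i<j<k$ with $\sigma(i)\sigma(j)\sigma(k)$ order-isomorphic to $\tau$), and put \begin{align*} \widetilde{\mathfrak S}_{n,k}(321)&=\{\sigma\in\mathfrak S_n(321):\mathsf{exc}\,\sigma=k,\ \mathsf{cda}\,\sigma=0\},\\ \widetilde{\mathfrak S}_{n,k}(\tau)&=\{\sigma\in\mathfrak S_n(\tau):\mathsf{des}\,\sigma=k,\ \mathsf{ldd}\,\sigma=0\}\quad(\tau\in\{231,312\}),\\ \widetilde{\mathfrak S}_{n,k}(\tau)&=\{\sigma\in\mathfrak S_n(\tau):\mathsf{asc}\,\sigma=k,\ \mathsf{rda}\,\sigma=0\}\quad(\tau\in\{132,213\}).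 \end{align*} Let $N_n(t,q,r)=\sum_{\sigma\in\mathfrak S_n(321)}t^{\mathsf{exc}\,\sigma}q^{\mathsf{inv}\,\sigma}r^{\mathsf{fix}\,\sigma}$. **Theorem.** Let $n\ge1$, and let $t,q$ be elements of a field with $q\ne0$ (for instance, independent indeterminates). Then $$N_n(t,q,t)=\sum_{\sigma\in\mathfrak S_n(321)}t^{\mathsf{wex}\,\sigma}q^{\mathsf{inv}\,\sigma}=\sum_{k=1}^{\lfloor (n+1)/2\rfloor}\widetilde\gamma_{n-1,k-1}(q)\,t^k\,(1+t/q)^{n+1-2k},$$ where, for every $k\ge1$, \begin{align*} \widetilde\gamma_{n-1,k-1}(q) &=\sum_{\pi\in\widetilde{\mathfrak S}_{n-1,k-1}(321)}q^{n-1+\mathsf{inv}\,\pi-\mathsf{exc}\,\pi}\\ &=\sum_{\pi\in\widetilde{\mathfrak S}_{n-1,k-1}(231)}q^{n-1+(31\text{-}2)\,\pi} =\sum_{\pi\in\widetilde{\mathfrak S}_{n-1,k-1}(312)}q^{n-1+(2\text{-}31)\,\pi}\\ &=\sum_{\pi\in\widetilde{\mathfrak S}_{n-1,k-1}(132)}q^{n-1+(2\text{-}13)\,\pi}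 =\sum_{\pi\in\widetilde{\mathfrak S}_{n-1,k-1}(213)}q^{n-1+(13\text{-}2)\,\pi}. \end{align*} -/

import Mathlib

open Finset

namespace QNarayana

/-! Permutations of `{1, …, n}` are modelled as `Equiv.Perm (Fin n)`, so that positions and values
are both shifted by one; all statistics below only compare positions and values. -/

/-- `σ` avoids the pattern `τ` (given in one-line notation): no increasing triple of positions
`f 0 < f 1 < f 2` has values order-isomorphic to `τ`. -/
def Avoids {n : ℕ} (σ : Equiv.Perm (Fin n)) (τ : Fin 3 → ℕ) : Prop :=
  ¬ ∃ f : Fin 3 → Fin n, (∀ a b, a < b → f a < f b) ∧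
      ∀ a b, σ (f a) < σ (f b) ↔ τ a < τ b

instance {n : ℕ} (σ : Equiv.Perm (Fin n)) (τ : Fin 3 → ℕ) : Decidable (Avoids σ τ) := by
  unfold Avoids; infer_instance

/-- The set `𝔖ₙ(τ)` of permutations of length `n` avoiding `τ`. -/
def avoiders (n : ℕ) (τ : Fin 3 → ℕ) : Finset (Equiv.Perm (Fin n)) :=
  univ.filter fun σ => Avoids σ τ

/-- Number of excedances. -/
def excNum {n : ℕ} (σ : Equiv.Perm (Fin n)) : ℕ :=
  #{i : Fin n | i < σ i}

/-- Number of weak excedances. -/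
def wexNum {n : ℕ} (σ : Equiv.Perm (Fin n)) : ℕ :=
  #{i : Fin n | i ≤ σ i}

/-- Number of fixed points. -/
def fixNum {n : ℕ} (σ : Equiv.Perm (Fin n)) : ℕ :=
  #{i : Fin n | σ i = i}

/-- Number of inversions. -/
def invNum {n : ℕ} (σ : Equiv.Perm (Fin n)) : ℕ :=
  #{p : Fin n × Fin n | p.1 < p.2 ∧ σ p.2 < σ p.1}

/-- Number of (cyclic) double excedances: values `x` with `σ⁻¹(x) < x < σ(x)`. -/
def cdaNum {n : ℕ} (σ : Equiv.Perm (Fin n)) : ℕ :=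
  #{x : Fin n | σ⁻¹ x < x ∧ x < σ x}

/-- Number of descents. -/
def desNum {n : ℕ} (σ : Equiv.Perm (Fin n)) : ℕ :=
  #{p : Fin n × Fin n | (p.2 : ℕ) = p.1 + 1 ∧ σ p.2 < σ p.1}

/-- Number of ascents. -/
def ascNum {n : ℕ} (σ : Equiv.Perm (Fin n)) : ℕ :=
  #{p : Fin n × Fin n | (p.2 : ℕ) = p.1 + 1 ∧ σ p.1 < σ p.2}

/-- The word `a σ(1) σ(2) ⋯ σ(n) b b ⋯`, with positions `0, 1, 2, …` and with the values of `σ`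
in `{1, …, n}`. -/
def padded {n : ℕ} (σ : Equiv.Perm (Fin n)) (a b : ℕ∞) (i : ℕ) : ℕ∞ :=
  if i = 0 then a
  else if h : i - 1 < n then (((σ ⟨i - 1, h⟩ : Fin n) : ℕ) + 1 : ℕ)
  else b

/-- Number of double descents `σ(i-1) > σ(i) > σ(i+1)`, `1 ≤ i ≤ n`, with the convention
`σ(0) = 0`, `σ(n+1) = ∞`. -/
def lddNum {n : ℕ} (σ : Equiv.Perm (Fin n)) : ℕ :=
  #{i ∈ Icc 1 n | padded σ 0 ⊤ i < padded σ 0 ⊤ (i - 1) ∧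
      padded σ 0 ⊤ (i + 1) < padded σ 0 ⊤ i}

/-- Number of double ascents `σ(i-1) < σ(i) < σ(i+1)`, `1 ≤ i ≤ n`, with the convention
`σ(0) = ∞`, `σ(n+1) = 0`. -/
def rdaNum {n : ℕ} (σ : Equiv.Perm (Fin n)) : ℕ :=
  #{i ∈ Icc 1 n | padded σ ⊤ 0 (i - 1) < padded σ ⊤ 0 i ∧
      padded σ ⊤ 0 i < padded σ ⊤ 0 (i + 1)}

/-- Occurrences of the vincular pattern `31-2`: positions `(i, i+1, j)` with `i + 1 < j` and
`σ(i+1) < σ(j) < σ(i)`. -/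
def v31_2 {n : ℕ} (σ : Equiv.Perm (Fin n)) : ℕ :=
  #{p : Fin n × Fin n × Fin n | (p.2.1 : ℕ) = p.1 + 1 ∧ p.2.1 < p.2.2 ∧
      σ p.2.1 < σ p.2.2 ∧ σ p.2.2 < σ p.1}

/-- Occurrences of the vincular pattern `2-31`: positions `(i, i+1, j)` with `j < i` and
`σ(i+1) < σ(j) < σ(i)`. -/
def v2_31 {n : ℕ} (σ : Equiv.Perm (Fin n)) : ℕ :=
  #{p : Fin n × Fin n × Fin n | (p.2.1 : ℕ) = p.1 + 1 ∧ p.2.2 < p.1 ∧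
      σ p.2.1 < σ p.2.2 ∧ σ p.2.2 < σ p.1}

/-- Occurrences of the vincular pattern `2-13`: positions `(i, i+1, j)` with `j < i` and
`σ(i) < σ(j) < σ(i+1)`. -/
def v2_13 {n : ℕ} (σ : Equiv.Perm (Fin n)) : ℕ :=
  #{p : Fin n × Fin n × Fin n | (p.2.1 : ℕ) = p.1 + 1 ∧ p.2.2 < p.1 ∧
      σ p.1 < σ p.2.2 ∧ σ p.2.2 < σ p.2.1}

/-- Occurrences of the vincular pattern `13-2`: positions `(i, i+1, j)` with `i + 1 < j` and
`σ(i) < σ(j) < σ(i+1)`. -/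
def v13_2 {n : ℕ} (σ : Equiv.Perm (Fin n)) : ℕ :=
  #{p : Fin n × Fin n × Fin n | (p.2.1 : ℕ) = p.1 + 1 ∧ p.2.1 < p.2.2 ∧
      σ p.1 < σ p.2.2 ∧ σ p.2.2 < σ p.2.1}

/-- The generalized `q`-Narayana polynomial `Nₙ(t, q, r)`. -/
def narayana {R : Type*} [CommSemiring R] (n : ℕ) (t q r : R) : R :=
  ∑ σ ∈ avoiders n ![3, 2, 1], t ^ excNum σ * q ^ invNum σ * r ^ fixNum σ

/-- 321-avoiders with `k` excedances and no double excedance. -/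
def tildeS321 (n k : ℕ) : Finset (Equiv.Perm (Fin n)) :=
  {σ ∈ avoiders n ![3, 2, 1] | excNum σ = k ∧ cdaNum σ = 0}

/-- 213-avoiders with `k` ascents and no double ascent (convention `∞–0`). -/
def tildeS213 (n k : ℕ) : Finset (Equiv.Perm (Fin n)) :=
  {σ ∈ avoiders n ![2, 1, 3] | ascNum σ = k ∧ rdaNum σ = 0}

/-- 312-avoiders with `k` descents and no double descent (convention `0–∞`). -/
def tildeS312 (n k : ℕ) : Finset (Equiv.Perm (Fin n)) :=
  {σ ∈ avoiders n ![3, 1, 2] | desNum σ = k ∧ lddNum σ = 0}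

/-- 132-avoiders with `k` ascents and no double ascent (convention `∞–0`). -/
def tildeS132 (n k : ℕ) : Finset (Equiv.Perm (Fin n)) :=
  {σ ∈ avoiders n ![1, 3, 2] | ascNum σ = k ∧ rdaNum σ = 0}

/-- 231-avoiders with `k` descents and no double descent (convention `0–∞`). -/
def tildeS231 (n k : ℕ) : Finset (Equiv.Perm (Fin n)) :=
  {σ ∈ avoiders n ![2, 3, 1] | desNum σ = k ∧ lddNum σ = 0}

/-- The number of excedances is at most `n`, so the exponent in `gammaTilde` is not truncated. -/
theorem excNum_le {n : ℕ} (σ : Equiv.Perm (Fin n)) : excNum σ ≤ n :=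
  (card_le_univ _).trans_eq (Fintype.card_fin n)

/-- The coefficient `γ̃_{m,j}(q) = ∑ q^{m + inv π - exc π}`, summed over the 321-avoiders `π` of
length `m` with `j` excedances and no double excedance. -/
def gammaTilde {R : Type*} [CommSemiring R] (m j : ℕ) (q : R) : R :=
  ∑ π ∈ tildeS321 m j, q ^ (m + invNum π - excNum π)

end QNarayana

open QNarayana

/-! A permutation `σ` avoiding 321 is increasing on its weak excedances and on the remaining
positions, so it is determined by the positions and the values of its weak excedances. Recording at
each `i` whether `i ≤ σ i` and whether `σ.symm i ≤ i` gives a two-coloured Motzkin path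
(`permWord_injOn`, `exists_permWord_eq`), whose heights sum to `invNum σ`
(`sum_wordHeight_permWord`). Sums over 321-avoiders thus become path sums in which every step
starting at height `h` carries `q ^ h`: `sum_wex_inv` for weak excedances and `sum_exc_inv_cda` for
excedances without double excedances.

The γ-expansion comes from factoring the transfer operator. For up, ground-level, level and down
weights `t`, `t`, `t + 1`, `1` it is `T = A (1 + S)`, where `(S f) h = f (h + 1)` and `(A f) h = q ^
h * (t * f h + f (h - 1))`, with `f (-1)` read as `0`. The swapped product `T' = (1 + S) A` has
weights `t * q`, `t + q`, `t + q`, `1`. Hence `T' (1 + S) = (1 + S) T`, which is `pathSum_regroup`,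
and `pathSum_succ_zero` follows. Level steps of `T'` have the same weight at all heights, so its
path sum counts 321-avoiders without double excedances, and `t + q = q * (1 + t / q)` gives the
expansion (`pathSum_eq_sum_gammaTilde`).

For 231, decomposing a word by its first letter gives the same recursion as decomposing a path at
its first return (`wordSum231_add_two`, `pathSum_add_two`). Under 231-avoidance the drops at
descents sum to `v31_2 + desNum` (`v31_2_add_desNum`). Comparing coefficients in `t` yields
`sum_tildeS321_inv`; complement, reversal and their composite transport the result to the other
three patterns. -/

namespace QNarayana

/-! ### Words of path steps and their weighted sums -/

/-- Increment of the height of a path at a step `(opens, closes)`. -/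
def stepDelta (a : Bool × Bool) : ℤ := (if a.1 then 1 else 0) - (if a.2 then 1 else 0)

/-- Height of a path before its step number `k`. -/
def wordHeight {n : ℕ} (w : Fin n → Bool × Bool) (k : ℕ) : ℤ :=
  ∑ j : Fin n, if (j : ℕ) < k then stepDelta (w j) else 0

/-- Sum of the weights of all paths with `n` steps from height `h` to height `0`. -/
def wordSum {R : Type*} [CommSemiring R] (c : ℤ → Bool × Bool → R) (n : ℕ) (h : ℤ) : R :=
  ∑ w : Fin n → Bool × Bool,
    (∏ i : Fin n, c (h + wordHeight w i) (w i)) * if h + wordHeight w n = 0 then 1 else 0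

theorem wordHeight_cons {n : ℕ} (a : Bool × Bool) (w : Fin n → Bool × Bool) (k : ℕ) :
    wordHeight (Fin.cons a w : Fin (n + 1) → Bool × Bool) (k + 1) =
      stepDelta a + wordHeight w k := by
  simp [wordHeight, Fin.sum_univ_succ]

theorem wordHeight_zero {n : ℕ} (w : Fin n → Bool × Bool) : wordHeight w 0 = 0 := by
  simp [wordHeight]

theorem wordHeight_succ {n : ℕ} (w : Fin n → Bool × Bool) (i : Fin n) :
    wordHeight w (i + 1) = wordHeight w i + stepDelta (w i) := by
  have h : ∀ j : Fin n, (if (j : ℕ) < i + 1 then stepDelta (w j) else 0) =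
      (if (j : ℕ) < i then stepDelta (w j) else 0) + if i = j then stepDelta (w j) else 0 := by
    intro j
    by_cases hij : i = j
    · subst hij; simp
    · have : (i : ℕ) ≠ j := fun e => hij (Fin.ext e)
      by_cases hlt : (j : ℕ) < i
      · simp [hij, hlt, Nat.lt_succ_of_lt hlt]
      · have : ¬ (j : ℕ) < i + 1 := by omega
        simp [hij, hlt, this]
  simp only [wordHeight, h, sum_add_distrib]
  simp

theorem wordSum_zero {R : Type*} [CommSemiring R] (c : ℤ → Bool × Bool → R) (h : ℤ) :
    wordSum c 0 h = if h = 0 then 1 else 0 := by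
  simp [wordSum, wordHeight]

theorem wordSum_succ {R : Type*} [CommSemiring R] (c : ℤ → Bool × Bool → R) (n : ℕ) (h : ℤ) :
    wordSum c (n + 1) h = ∑ a : Bool × Bool, c h a * wordSum c n (h + stepDelta a) := by
  unfold wordSum
  rw [← (Fin.consEquiv (fun _ : Fin (n + 1) => Bool × Bool)).sum_comp, Fintype.sum_prod_type]
  refine Finset.sum_congr rfl fun a _ => ?_
  rw [Finset.mul_sum]
  refine Finset.sum_congr rfl fun w _ => ?_
  rw [Fin.prod_univ_succ]
  have e : (Fin.consEquiv (fun _ : Fin (n + 1) => Bool × Bool)) (a, w) = Fin.cons a w := rfl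
  simp only [e, Fin.val_succ, Fin.val_zero, Fin.cons_zero, Fin.cons_succ,
    wordHeight_cons, wordHeight_zero, add_zero, add_assoc, mul_assoc]

/-! ### Permutations avoiding 321 -/

theorem avoids_iff {n : ℕ} (σ : Equiv.Perm (Fin n)) (τ : Fin 3 → ℕ) :
    Avoids σ τ ↔ ∀ i j k : Fin n, i < j → j < k →
      ¬ ∀ a b, σ (![i, j, k] a) < σ (![i, j, k] b) ↔ τ a < τ b := by
  unfold Avoids
  constructor
  · intro h i j k hij hjk hab
    refine h ⟨![i, j, k], ?_, hab⟩
    intro a b hlt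
    fin_cases a <;> fin_cases b <;> simp at hlt ⊢ <;> first | assumption | exact hij.trans hjk
  · rintro h ⟨f, hf, hab⟩
    refine h (f 0) (f 1) (f 2) (hf _ _ (by decide)) (hf _ _ (by decide)) ?_
    have : ![f 0, f 1, f 2] = f := by
      ext a; fin_cases a <;> rfl
    rw [this]
    exact hab

theorem avoids_321_iff {n : ℕ} (σ : Equiv.Perm (Fin n)) :
    Avoids σ ![3, 2, 1] ↔ ∀ i j k : Fin n, i < j → j < k → ¬ (σ j < σ i ∧ σ k < σ j) := by
  rw [avoids_iff]
  refine forall₅_congr fun i j k _ _ => not_congr ?_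
  simp [Fin.forall_fin_succ]
  omega

theorem avoids_231_iff {n : ℕ} (σ : Equiv.Perm (Fin n)) :
    Avoids σ ![2, 3, 1] ↔ ∀ i j k : Fin n, i < j → j < k → ¬ (σ k < σ i ∧ σ i < σ j) := by
  rw [avoids_iff]
  refine forall₅_congr fun i j k _ _ => not_congr ?_
  simp [Fin.forall_fin_succ]
  omega

theorem avoids_312_iff {n : ℕ} (σ : Equiv.Perm (Fin n)) :
    Avoids σ ![3, 1, 2] ↔ ∀ i j k : Fin n, i < j → j < k → ¬ (σ j < σ k ∧ σ k < σ i) := by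
  rw [avoids_iff]
  refine forall₅_congr fun i j k _ _ => not_congr ?_
  simp [Fin.forall_fin_succ]
  omega

theorem avoids_132_iff {n : ℕ} (σ : Equiv.Perm (Fin n)) :
    Avoids σ ![1, 3, 2] ↔ ∀ i j k : Fin n, i < j → j < k → ¬ (σ i < σ k ∧ σ k < σ j) := by
  rw [avoids_iff]
  refine forall₅_congr fun i j k _ _ => not_congr ?_
  simp [Fin.forall_fin_succ]
  omega

theorem avoids_213_iff {n : ℕ} (σ : Equiv.Perm (Fin n)) :
    Avoids σ ![2, 1, 3] ↔ ∀ i j k : Fin n, i < j → j < k → ¬ (σ j < σ i ∧ σ i < σ k) := by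
  rw [avoids_iff]
  refine forall₅_congr fun i j k _ _ => not_congr ?_
  simp [Fin.forall_fin_succ]
  omega

section
variable {n : ℕ} {σ : Equiv.Perm (Fin n)}

theorem card_filter_apply_lt (σ : Equiv.Perm (Fin n)) (x : Fin n) :
    #{j : Fin n | σ j < x} = x := by
  refine Eq.trans ?_ (Fin.card_Iio x)
  rw [← card_map σ.toEmbedding]
  congr 1
  ext j
  simp

/-- In a 321-avoiding permutation, a weak excedance is a left-to-right maximum. -/
theorem lt_of_lt_of_wex (h : Avoids σ ![3, 2, 1]) {i j : Fin n} (hi : i ≤ σ i) (hj : j < i) :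
    σ j < σ i := by
  rw [avoids_321_iff] at h
  by_contra hlt
  have hlt : σ i < σ j := lt_of_le_of_ne (not_lt.mp hlt) (fun e => hj.ne (σ.injective e).symm)
  have hsub : ({k : Fin n | σ k < σ i} : Finset (Fin n)) ⊆ (Iio i).erase j := by
    intro k hk
    simp only [mem_filter, mem_univ, true_and] at hk
    have hki : ¬ i < k := fun hik => h j i k hj hik ⟨hlt, hk⟩
    have h1 : k ≠ i := by rintro rfl; exact lt_irrefl _ hk
    have h2 : k ≠ j := by rintro rfl; exact lt_asymm hk hlt
    simp only [mem_erase, mem_Iio]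
    exact ⟨h2, lt_of_le_of_ne (not_lt.mp hki) h1⟩
  have hc := card_le_card hsub
  rw [card_filter_apply_lt, card_erase_of_mem (by simpa using hj), Fin.card_Iio] at hc
  have h1 : (j : ℕ) < i := hj
  have h2 : (i : ℕ) ≤ σ i := hi
  omega

/-- In a 321-avoiding permutation, an anti-excedance is a right-to-left minimum. -/
theorem lt_of_lt_of_not_wex (h : Avoids σ ![3, 2, 1]) {i k : Fin n} (hi : σ i < i) (hk : i < k) :
    σ i < σ k := by
  rw [avoids_321_iff] at h
  by_contra hlt
  have hlt : σ k < σ i := lt_of_le_of_ne (not_lt.mp hlt) (fun e => hk.ne (σ.injective e).symm)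
  have hsub : Iio i ⊆ ({k : Fin n | σ k < σ i} : Finset (Fin n)) := by
    intro j hj
    simp only [mem_filter, mem_univ, true_and]
    have hj := mem_Iio.mp hj
    by_contra hc
    have : σ i < σ j := lt_of_le_of_ne (not_lt.mp hc) (fun e => hj.ne (σ.injective e).symm)
    exact h j i k hj hk ⟨this, hlt⟩
  have hc := card_le_card hsub
  rw [card_filter_apply_lt, Fin.card_Iio] at hc
  have h2 : (σ i : ℕ) < i := hi
  omega

/-- The path of a permutation. -/
def permWord (σ : Equiv.Perm (Fin n)) (i : Fin n) : Bool × Bool :=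
  (decide (i ≤ σ i), decide (σ.symm i ≤ i))

/-- Each weak excedance `j` is an arc opened at `j` and closed at `σ j`; the other positions
contribute no arc. The height counts the arcs open at `k`, and a fixed point opens and closes its
arc in a single step. -/
theorem wordHeight_permWord (σ : Equiv.Perm (Fin n)) (k : ℕ) :
    wordHeight (permWord σ) k = #{j : Fin n | (j : ℕ) < k ∧ k ≤ (σ j : ℕ)} := by
  have h1 : wordHeight (permWord σ) k =
      (∑ j : Fin n, if (j : ℕ) < k then (if j ≤ σ j then 1 else 0 : ℤ) else 0) -
      ∑ j : Fin n, if (j : ℕ) < k then (if σ.symm j ≤ j then 1 else 0 : ℤ) else 0 := by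
    rw [← sum_sub_distrib]
    refine sum_congr rfl fun j _ => ?_
    by_cases hk : (j : ℕ) < k
    · simp only [hk, if_true, stepDelta, permWord, decide_eq_true_eq]
    · simp only [hk, if_false, sub_self]
  -- The closing sum is reindexed by `x = σ j`, so that both ends of an arc are seen at `j`.
  rw [h1, ← Equiv.sum_comp σ (fun j : Fin n => if (j : ℕ) < k then
    (if σ.symm j ≤ j then 1 else 0 : ℤ) else 0), ← sum_sub_distrib, card_filter]
  push_cast
  refine sum_congr rfl fun j _ => ?_
  simp only [Equiv.symm_apply_apply, Fin.le_def]
  split_ifs <;> first | rfl | omega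

theorem wordHeight_permWord_end (σ : Equiv.Perm (Fin n)) : wordHeight (permWord σ) n = 0 := by
  rw [wordHeight_permWord]
  simp only [Nat.cast_eq_zero, card_eq_zero, filter_eq_empty_iff]
  intro j _ h
  have := (σ j).isLt
  omega

/-- Double counting: a weak excedance `i` contributes to `σ i - i` heights. Since all `i` earlier
values are smaller, exactly `σ i - i` smaller values follow it. An anti-excedance contributes to no
height and is the left end of no inversion. -/
theorem sum_wordHeight_permWord (h : Avoids σ ![3, 2, 1]) :
    ∑ i : Fin n, wordHeight (permWord σ) i = invNum σ := by
  simp only [wordHeight_permWord]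
  rw [← Nat.cast_sum, Nat.cast_inj, invNum, card_filter, Fintype.sum_prod_type]
  simp only [card_filter]
  rw [sum_comm]
  refine sum_congr rfl fun i _ => ?_
  rw [← card_filter, ← card_filter]
  by_cases hi : i ≤ σ i
  · have h1 : ({k : Fin n | (i : ℕ) < k ∧ (k : ℕ) ≤ σ i} : Finset (Fin n)) = Ioc i (σ i) := by
      ext k; simp
    have h2 : ({k : Fin n | σ k < σ i} : Finset (Fin n)) =
        Iio i ∪ ({k : Fin n | i < k ∧ σ k < σ i} : Finset (Fin n)) := by
      ext k
      simp only [mem_filter, mem_univ, true_and, mem_union, mem_Iio]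
      constructor
      · intro hk
        rcases lt_trichotomy k i with h' | h' | h'
        · exact Or.inl h'
        · subst h'; exact absurd hk (lt_irrefl _)
        · exact Or.inr ⟨h', hk⟩
      · rintro (hk | hk)
        · exact lt_of_lt_of_wex h hi hk
        · exact hk.2
    have h3 := congrArg card h2
    rw [card_union_of_disjoint, card_filter_apply_lt, Fin.card_Iio] at h3
    · rw [h1, Fin.card_Ioc]; omega
    · rw [disjoint_left]; intro k hk hk'
      simp only [mem_filter, mem_univ, true_and, mem_Iio] at hk hk'
      exact lt_asymm hk hk'.1
  · have hi := not_le.mp hi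
    rw [filter_eq_empty_iff.mpr, filter_eq_empty_iff.mpr]
    · rintro k - ⟨h1, h2⟩
      exact lt_asymm h2 (lt_of_lt_of_not_wex h hi h1)
    · rintro k - ⟨h1, h2⟩
      have : (σ i : ℕ) < i := hi
      omega

theorem wordHeight_permWord_nonneg (σ : Equiv.Perm (Fin n)) (k : ℕ) :
    0 ≤ wordHeight (permWord σ) k := by
  rw [wordHeight_permWord]; positivity

theorem wordHeight_permWord_pos_of_lt {i : Fin n} (hi : σ.symm i < i) :
    0 < wordHeight (permWord σ) i := by
  rw [wordHeight_permWord, Nat.cast_pos, card_pos]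
  exact ⟨σ.symm i, by simpa using hi⟩

/-- Pigeonhole: with no arc open at `i`, all `i + 1` positions up to `i` would have values below
`i`. -/
theorem wordHeight_permWord_pos_of_not_wex {i : Fin n} (hi : σ i < i) :
    0 < wordHeight (permWord σ) i := by
  rw [wordHeight_permWord, Nat.cast_pos, card_pos]
  by_contra hne
  rw [not_nonempty_iff_eq_empty, filter_eq_empty_iff] at hne
  have hsub : Iic i ⊆ ({k : Fin n | σ k < i} : Finset (Fin n)) := by
    intro j hj
    simp only [mem_filter, mem_univ, true_and]
    rcases (mem_Iic.mp hj).eq_or_lt with rfl | hlt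
    · exact hi
    · have := hne (mem_univ j)
      simp only [Fin.lt_def] at hlt ⊢
      omega
  have hc := card_le_card hsub
  rw [card_filter_apply_lt, Fin.card_Iic] at hc
  omega

theorem wordHeight_permWord_fix (h : Avoids σ ![3, 2, 1]) {i : Fin n} (hi : σ i = i) :
    wordHeight (permWord σ) i = 0 := by
  rw [wordHeight_permWord, Nat.cast_eq_zero, card_eq_zero, filter_eq_empty_iff]
  rintro j - ⟨h1, h2⟩
  have h3 := lt_of_lt_of_wex h hi.ge (j := j) h1
  rw [hi, Fin.lt_def] at h3
  omega

/-- An increasing map on `p` sends the `r`-th element of `p` to the `r`-th element of the image, so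
the image determines it. In the proof, `key` computes this rank and `main` says that different
values have different ranks. -/
theorem eqOn_of_strictMonoOn {σ τ : Equiv.Perm (Fin n)} {p : Fin n → Prop} [DecidablePred p]
    (hσ : ∀ i j, p i → p j → i < j → σ i < σ j) (hτ : ∀ i j, p i → p j → i < j → τ i < τ j)
    (him : ∀ x, p (σ.symm x) ↔ p (τ.symm x)) {i : Fin n} (hi : p i) : σ i = τ i := by
  have key : ∀ ρ : Equiv.Perm (Fin n), (∀ i j, p i → p j → i < j → ρ i < ρ j) →
      #{x : Fin n | p (ρ.symm x) ∧ x < ρ i} = #{j : Fin n | p j ∧ j < i} := by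
    intro ρ hρ
    refine Eq.trans ?_ (card_map ρ.toEmbedding)
    congr 1
    ext x
    simp only [mem_filter, mem_univ, true_and, mem_map, Equiv.coe_toEmbedding]
    constructor
    · rintro ⟨h1, h2⟩
      refine ⟨ρ.symm x, ⟨h1, ?_⟩, by simp⟩
      by_contra hc
      rcases (not_lt.mp hc).eq_or_lt with h | h
      · rw [h] at h2; simp at h2
      · have := hρ _ _ hi h1 h
        simp only [Equiv.apply_symm_apply] at this
        exact lt_asymm this h2
    · rintro ⟨j, ⟨h1, h2⟩, rfl⟩
      simpa [h1] using hρ _ _ h1 hi h2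
  have main : ∀ ρ ρ' : Equiv.Perm (Fin n), (∀ x, p (ρ.symm x) ↔ p (ρ'.symm x)) →
      #{x : Fin n | p (ρ.symm x) ∧ x < ρ i} = #{x : Fin n | p (ρ'.symm x) ∧ x < ρ' i} →
      ¬ ρ i < ρ' i := by
    intro ρ ρ' hp hc hlt
    refine (card_lt_card (ssubset_iff_of_subset ?_ |>.mpr ⟨ρ i, ?_, ?_⟩)).ne hc
    · intro x
      simp only [mem_filter, mem_univ, true_and, hp]
      exact fun hx => ⟨hx.1, hx.2.trans hlt⟩
    · simp only [mem_filter, mem_univ, true_and, ← hp]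
      simpa using ⟨hi, hlt⟩
    · simp
  have e := (key σ hσ).trans (key τ hτ).symm
  exact le_antisymm (not_lt.mp (main τ σ (fun x => (him x).symm) e.symm))
    (not_lt.mp (main σ τ him e))

theorem permWord_injOn {σ τ : Equiv.Perm (Fin n)} (hσ : Avoids σ ![3, 2, 1])
    (hτ : Avoids τ ![3, 2, 1]) (h : permWord σ = permWord τ) : σ = τ := by
  have h1 : ∀ i, i ≤ σ i ↔ i ≤ τ i := fun i => by
    have := congrArg Prod.fst (congrFun h i)
    simpa [permWord] using this
  have h2 : ∀ i, σ.symm i ≤ i ↔ τ.symm i ≤ i := fun i => by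
    have := congrArg Prod.snd (congrFun h i)
    simpa [permWord] using this
  have him : ∀ x, σ.symm x ≤ σ (σ.symm x) ↔ τ.symm x ≤ σ (τ.symm x) := fun x => by
    rw [h1 (τ.symm x)]; simpa using h2 x
  refine Equiv.ext fun i => ?_
  by_cases hi : i ≤ σ i
  · refine eqOn_of_strictMonoOn (p := fun i => i ≤ σ i) (fun i j _ hj hij =>
      lt_of_lt_of_wex hσ hj hij) (fun i j _ hj hij => lt_of_lt_of_wex hτ ((h1 j).mp hj) hij)
      him hi
  · refine eqOn_of_strictMonoOn (p := fun i => ¬ i ≤ σ i) (fun i j hi _ hij =>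
      lt_of_lt_of_not_wex hσ (not_le.mp hi) hij) (fun i j hi _ hij =>
      lt_of_lt_of_not_wex hτ (not_le.mp (mt (h1 i).mpr hi)) hij) (fun x => not_congr (him x)) hi

end
-- From a path back to a 321-avoiding permutation
theorem exists_orderIso_of_card_eq {n : ℕ} {p q : Fin n → Prop} [DecidablePred p] [DecidablePred q]
    (h : #{i | p i} = #{i | q i}) : Nonempty ({i // p i} ≃o {i // q i}) := by
  have e := (orderIsoOfFin ({i | p i} : Finset (Fin n)) h).symm.trans
    (orderIsoOfFin ({i | q i} : Finset (Fin n)) rfl)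
  have h1 : ∀ {r : Fin n → Prop} [DecidablePred r],
      Nonempty ({i // i ∈ ({i | r i} : Finset (Fin n))} ≃o {i // r i}) := fun {r} _ =>
    ⟨{ toEquiv := Equiv.subtypeEquivRight (by simp), map_rel_iff' := Iff.rfl }⟩
  exact ⟨(h1.some.symm.trans e).trans h1.some⟩

theorem exists_perm_strictMono {n : ℕ} {p q : Fin n → Prop} [DecidablePred p] [DecidablePred q]
    (h : #{i | p i} = #{i | q i}) :
    ∃ σ : Equiv.Perm (Fin n), (∀ i, q (σ i) ↔ p i) ∧ (∀ i j, p i → p j → i < j → σ i < σ j) ∧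
      (∀ i j, ¬ p i → ¬ p j → i < j → σ i < σ j) := by
  have h' : #{i | ¬ p i} = #{i | ¬ q i} := by
    have h1 : #{i | p i} + #{i | ¬ p i} = _ := card_filter_add_card_filter_not (s := univ) p
    have h2 : #{i | q i} + #{i | ¬ q i} = _ := card_filter_add_card_filter_not (s := univ) q
    omega
  obtain ⟨e⟩ := exists_orderIso_of_card_eq h
  obtain ⟨e'⟩ := exists_orderIso_of_card_eq h'
  have hp : ∀ i (hi : p i), Equiv.subtypeCongr e.toEquiv e'.toEquiv i = e ⟨i, hi⟩ := fun i hi => by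
    simp [Equiv.subtypeCongr, Equiv.sumCompl_symm_apply_of_pos hi]
  have hn : ∀ i (hi : ¬ p i), Equiv.subtypeCongr e.toEquiv e'.toEquiv i = e' ⟨i, hi⟩ :=
    fun i hi => by simp [Equiv.subtypeCongr, Equiv.sumCompl_symm_apply_of_neg hi]
  refine ⟨Equiv.subtypeCongr e.toEquiv e'.toEquiv, fun i => ?_, fun i j hi hj hij => ?_,
    fun i j hi hj hij => ?_⟩
  · by_cases hi : p i
    · simpa [hp i hi, hi] using (e ⟨i, hi⟩).2
    · simpa [hn i hi, hi] using (e' ⟨i, hi⟩).2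
  · rw [hp i hi, hp j hj]
    exact e.strictMono hij
  · rw [hn i hi, hn j hj]
    exact e'.strictMono hij

/-- Number of `j < k` with the property `p`. -/
def countBelow {n : ℕ} (p : Fin n → Prop) [DecidablePred p] (k : ℕ) : ℕ :=
  #{j : Fin n | p j ∧ (j : ℕ) < k}

theorem countBelow_mono {n : ℕ} (p : Fin n → Prop) [DecidablePred p] {k l : ℕ} (h : k ≤ l) :
    countBelow p k ≤ countBelow p l :=
  card_le_card fun j => by
    simp only [mem_filter, mem_univ, true_and]
    exact fun hj => ⟨hj.1, hj.2.trans_le h⟩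

theorem countBelow_succ {n : ℕ} (p : Fin n → Prop) [DecidablePred p] (i : Fin n) :
    countBelow p (i + 1) = countBelow p i + if p i then 1 else 0 := by
  unfold countBelow
  rw [card_filter, card_filter, ← Fintype.sum_ite_eq i (fun j => if p j then 1 else 0),
    ← sum_add_distrib]
  refine sum_congr rfl fun j _ => ?_
  by_cases hij : i = j
  · subst hij; simp
  · have : (i : ℕ) ≠ j := fun e => hij (Fin.ext e)
    have : (j : ℕ) < i + 1 ↔ (j : ℕ) < i := by omega
    simp [hij, this]

theorem countBelow_not {n : ℕ} (p : Fin n → Prop) [DecidablePred p] {k : ℕ} (hk : k ≤ n) :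
    countBelow p k + countBelow (fun i => ¬ p i) k = k := by
  unfold countBelow
  have h : #{j : Fin n | (j : ℕ) < k} = k := by
    rcases hk.eq_or_lt with rfl | hk
    · simp
    · refine Eq.trans ?_ (Fin.card_Iio (⟨k, hk⟩ : Fin n))
      congr 1
      ext j
      simp [Fin.lt_def]
  conv_rhs => rw [← h]
  rw [← card_filter_add_card_filter_not (s := ({j : Fin n | (j : ℕ) < k} : Finset (Fin n))) p]
  simp only [filter_filter, and_comm]

theorem countBelow_apply {n : ℕ} {p q : Fin n → Prop} [DecidablePred p] [DecidablePred q]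
    {σ : Equiv.Perm (Fin n)} (hpq : ∀ i, q (σ i) ↔ p i)
    (hσ : ∀ i j, p i → p j → i < j → σ i < σ j) {i : Fin n} (hi : p i) :
    countBelow q (σ i) = countBelow p i := by
  unfold countBelow
  refine Eq.trans ?_ (card_map σ.toEmbedding)
  congr 1
  ext x
  obtain ⟨j, rfl⟩ := σ.surjective x
  simp only [mem_filter, mem_univ, true_and, hpq, mem_map, Equiv.coe_toEmbedding,
    EmbeddingLike.apply_eq_iff_eq, exists_eq_right, ← Fin.lt_def]
  refine and_congr_right fun hj => ⟨fun h => ?_, hσ j i hj hi⟩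
  by_contra hc
  rcases (not_lt.mp hc).eq_or_lt with e | hlt
  · exact h.ne (congrArg σ e.symm)
  · exact lt_asymm h (hσ i j hi hj hlt)

theorem wordHeight_eq_countBelow {n : ℕ} (w : Fin n → Bool × Bool) (k : ℕ) :
    wordHeight w k =
      (countBelow (fun i => (w i).1 = true) k : ℤ) - countBelow (fun i => (w i).2 = true) k := by
  simp only [wordHeight, countBelow, card_filter]
  push_cast
  rw [← sum_sub_distrib]
  refine sum_congr rfl fun j _ => ?_
  by_cases hj : (j : ℕ) < k <;> simp [hj, stepDelta]

/-- Openers are matched with closers, and non-openers with non-closers, both in increasing order.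
The height conditions turn openers into weak excedances and non-openers into anti-excedances. Of
three positions two lie in the same class, which rules out 321. -/
theorem exists_permWord_eq {n : ℕ} (w : Fin n → Bool × Bool)
    (hw : ∀ i, (w i).1 = false → 0 < wordHeight w i) (hn : wordHeight w n = 0) :
    ∃ σ : Equiv.Perm (Fin n), Avoids σ ![3, 2, 1] ∧ permWord σ = w := by
  -- Only a non-opener can lower the height, and there the height is positive.
  have hnn : ∀ k ≤ n, 0 ≤ wordHeight w k := by
    intro k hk
    induction k with
    | zero => rw [wordHeight_zero]
    | succ k ih =>
      have ih := ih (by omega)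
      have e := wordHeight_succ w ⟨k, hk⟩
      have h1 := hw ⟨k, hk⟩
      simp only [stepDelta] at e h1
      rw [e]
      cases h : (w ⟨k, hk⟩).1 <;> simp only [h, forall_const] at h1 ⊢ <;> split_ifs <;> grind
  set p : Fin n → Prop := fun i => (w i).1 = true with hp
  set q : Fin n → Prop := fun i => (w i).2 = true with hq
  have hht : ∀ k, wordHeight w k = (countBelow p k : ℤ) - countBelow q k :=
    wordHeight_eq_countBelow w
  have hcard : #{i | p i} = #{i | q i} := by
    have := hht n
    rw [hn] at this
    have h2 : countBelow p n = countBelow q n := by omega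
    simpa [countBelow] using h2
  obtain ⟨σ, hpq, h1, h2⟩ := exists_perm_strictMono hcard
  -- If `σ i < i`, the closers up to and including `σ i` outnumber the openers before `i`, making
  -- the height at `σ i + 1` negative.
  have hE : ∀ i, p i → i ≤ σ i := by
    intro i hi
    by_contra hc
    have hc : (σ i : ℕ) < i := not_le.mp hc
    have e1 := countBelow_apply hpq h1 hi
    have e2 := countBelow_succ q (σ i)
    rw [if_pos ((hpq i).mpr hi)] at e2
    have e3 := countBelow_mono p (k := σ i + 1) (l := i) hc
    have e4 := hnn (σ i + 1) (σ i).isLt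
    rw [hht] at e4
    omega
  -- If `σ i = i`, the height at `i` is zero, which is forbidden at a non-opener. If `i < σ i`, the
  -- non-openers up to `i` outnumber the non-closers there, making the height at `i + 1` negative.
  have hF : ∀ i, ¬ p i → σ i < i := by
    intro i hi
    by_contra hc
    have hc := not_lt.mp hc
    have e1 := countBelow_apply (p := fun i => ¬ p i) (q := fun i => ¬ q i)
      (fun i => not_congr (hpq i)) h2 hi
    have f1 := countBelow_not p (k := i) i.isLt.le
    have f2 := countBelow_not q (k := i) i.isLt.le
    have f3 := hw i (by simpa [hp] using hi)
    rw [hht] at f3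
    rcases hc.eq_or_lt with e | hlt
    · rw [← e] at e1
      omega
    · have hlt : (i : ℕ) < σ i := hlt
      have g1 := countBelow_succ (fun i => ¬ p i) i
      rw [if_pos hi] at g1
      have g2 := countBelow_mono (fun i => ¬ q i) (k := i + 1) (l := σ i) hlt
      have g3 := countBelow_not p (k := i + 1) i.isLt
      have g4 := countBelow_not q (k := i + 1) i.isLt
      have g5 := hnn (i + 1) i.isLt
      rw [hht] at g5
      omega
  refine ⟨σ, ?_, funext fun i => ?_⟩
  · rw [avoids_321_iff]
    rintro i j k hij hjk ⟨a, b⟩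
    have m1 := h1 i j
    have m2 := h1 j k
    have m3 := h1 i k
    have m4 := h2 i j
    have m5 := h2 j k
    have m6 := h2 i k
    have c := b.trans a
    have d := hij.trans hjk
    by_cases pi : p i <;> by_cases pj : p j <;> by_cases pk : p k <;>
      simp only [pi, pj, pk, forall_const, not_true, not_false_iff, hij, hjk, d] at m1 m2 m3 m4 m5 m6 <;>
      first
        | exact lt_asymm a m1 | exact lt_asymm b m2 | exact lt_asymm c m3
        | exact lt_asymm a m4 | exact lt_asymm b m5 | exact lt_asymm c m6
  · have hE' : i ≤ σ i ↔ p i := ⟨fun h => by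
      by_contra hc; exact absurd (hF i hc) (not_lt.mpr h), hE i⟩
    have hE'' : σ.symm i ≤ i ↔ q i := by
      have := hpq (σ.symm i)
      rw [Equiv.apply_symm_apply] at this
      rw [this]
      have h3 := hE (σ.symm i)
      have h4 := hF (σ.symm i)
      rw [Equiv.apply_symm_apply] at h3 h4
      exact ⟨fun h => by by_contra hc; exact absurd (h4 hc) (not_lt.mpr h), h3⟩
    refine Prod.ext ?_ ?_
    · simp only [permWord, hE', hp, Bool.decide_eq_true]
    · simp only [permWord, hE'', hq, Bool.decide_eq_true]

/-- The weighted sum over 321-avoiding permutations is a sum over paths. -/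
theorem sum_avoiders_321_eq_wordSum {R : Type*} [CommSemiring R] (c : ℤ → Bool × Bool → R)
    (hc : ∀ h ≤ 0, ∀ b, c h (false, b) = 0) (n : ℕ) :
    ∑ σ ∈ avoiders n ![3, 2, 1], ∏ i : Fin n, c (wordHeight (permWord σ) i) (permWord σ i) =
      wordSum c n 0 := by
  unfold wordSum
  simp only [zero_add]
  refine sum_of_injOn permWord ?_ (fun _ _ => by simp) ?_ ?_
  · intro σ hσ τ hτ h
    simp only [avoiders, coe_filter, mem_univ, true_and, Set.mem_ofPred_eq] at hσ hτ
    exact permWord_injOn hσ hτ h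
  · intro w _ hw
    by_contra hne
    have hv : ∀ i, (w i).1 = false → 0 < wordHeight w i := fun i hi => by
      by_contra hle
      refine hne (mul_eq_zero_of_left (prod_eq_zero (mem_univ i) ?_) _)
      rw [show w i = (false, (w i).2) from Prod.ext hi rfl]
      exact hc _ (not_lt.mp hle) _
    have hend : wordHeight w n = 0 := by
      by_contra h0
      exact hne (by rw [if_neg h0, mul_zero])
    obtain ⟨σ, h1, h2⟩ := exists_permWord_eq w hv hend
    exact hw ⟨σ, by simpa [avoiders] using h1, h2⟩
  · intro σ _
    rw [if_pos (wordHeight_permWord_end σ), mul_one]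

/-! ### Motzkin path sums and the statistics of 321-avoiders -/

/-- Weighted sum of Motzkin paths with `n` steps from height `h` to height `0`: up steps have
weight `u`, down steps `1`, level steps `f` at height `0` and `l` above, and every step that starts
at height `j` has in addition the weight `q ^ j`. -/
def pathSum {R : Type*} [CommSemiring R] (u f l q : R) : ℕ → ℕ → R
  | 0, h => if h = 0 then 1 else 0
  | n + 1, 0 => u * pathSum u f l q n 1 + f * pathSum u f l q n 0
  | n + 1, h + 1 => q ^ (h + 1) *
      (u * pathSum u f l q n (h + 2) + l * pathSum u f l q n (h + 1) + pathSum u f l q n h)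

/-- Step weights of two-coloured Motzkin paths. -/
def stepWeight {R : Type*} [CommSemiring R] (u f y b q : R) (h : ℤ) (a : Bool × Bool) : R :=
  q ^ h.toNat * bif a.1 then (bif a.2 then (if h ≤ 0 then f else y) else u) else
    (if h ≤ 0 then 0 else bif a.2 then 1 else b)

/-- Above the ground the two colours of a level step merge into the weight `y + b`; on the ground
only the colour that opens and closes survives. -/
theorem wordSum_stepWeight {R : Type*} [CommSemiring R] (u f y b q : R) (n h : ℕ) :
    wordSum (stepWeight u f y b q) n h = pathSum u f (y + b) q n h := by
  induction n generalizing h with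
  | zero => simp [wordSum_zero, pathSum]
  | succ n ih =>
    rw [wordSum_succ, Fintype.sum_prod_type]
    cases h with
    | zero =>
      have := ih 0
      have := ih 1
      simp_all [stepWeight, stepDelta, pathSum]
      ring
    | succ h =>
      have h0 := ih h
      have h1 := ih (h + 1)
      have h2 := ih (h + 2)
      have e0 : ((h + 1 : ℕ) : ℤ) + -1 = h := by push_cast; ring
      have e2 : ((h + 1 : ℕ) : ℤ) + 1 = (h + 2 : ℕ) := by push_cast; ring
      have e3 : ¬ ((h + 1 : ℕ) : ℤ) ≤ 0 := by omega
      have e4 : ((h + 1 : ℕ) : ℤ).toNat = h + 1 := rfl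
      simp only [stepWeight, stepDelta, pathSum, Fintype.sum_bool, if_true, sub_self, add_zero,
        sub_zero, zero_sub, e0, e2, e3, e4, h0, h1, h2, if_false, cond_true, cond_false,
        Bool.false_eq_true]
      ring

variable {n : ℕ}

theorem prod_pow_wordHeight {R : Type*} [CommSemiring R] {σ : Equiv.Perm (Fin n)}
    (h : Avoids σ ![3, 2, 1]) (q : R) :
    ∏ i : Fin n, q ^ (wordHeight (permWord σ) i).toNat = q ^ invNum σ := by
  rw [prod_pow_eq_pow_sum]
  congr 1
  have h1 := sum_wordHeight_permWord h
  zify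
  rw [← h1]
  exact sum_congr rfl fun i _ => Int.toNat_of_nonneg (wordHeight_permWord_nonneg σ i)

theorem stepWeight_zero_of_nonpos {R : Type*} [CommSemiring R] (u f y b q : R) (h : ℤ)
    (hh : h ≤ 0) (b' : Bool) : stepWeight u f y b q h (false, b') = 0 := by
  simp [stepWeight, hh]

theorem sum_wex_inv {R : Type*} [CommSemiring R] (n : ℕ) (t q : R) :
    ∑ σ ∈ avoiders n ![3, 2, 1], t ^ wexNum σ * q ^ invNum σ = pathSum t t (t + 1) q n 0 := by
  rw [← wordSum_stepWeight, Nat.cast_zero,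
    ← sum_avoiders_321_eq_wordSum _ (stepWeight_zero_of_nonpos _ _ _ _ _)]
  refine sum_congr rfl fun σ hσ => ?_
  have hσ : Avoids σ ![3, 2, 1] := (mem_filter.mp hσ).2
  simp only [stepWeight, prod_mul_distrib]
  rw [prod_pow_wordHeight hσ, mul_comm, wexNum, ← prod_const, prod_filter]
  congr 1
  refine prod_congr rfl fun i _ => ?_
  by_cases hi : i ≤ σ i
  · simp [permWord, hi]
  · have := wordHeight_permWord_pos_of_not_wex (not_le.mp hi)
    simp [permWord, hi, not_le.mpr this]

theorem card_anti (σ : Equiv.Perm (Fin n)) : #{i : Fin n | σ.symm i < i} = excNum σ := by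
  rw [excNum]
  refine Eq.trans ?_ (card_map σ.toEmbedding)
  congr 1
  ext x
  obtain ⟨j, rfl⟩ := σ.surjective x
  simp

/-- Without double excedances, the excedance positions and the excedance values are disjoint sets of
equal size. -/
theorem card_rest {σ : Equiv.Perm (Fin n)} (h : cdaNum σ = 0) :
    #{i : Fin n | ¬ i < σ i ∧ ¬ σ.symm i < i} + 2 * excNum σ = n := by
  have hd : Disjoint ({i : Fin n | i < σ i} : Finset _) ({i : Fin n | σ.symm i < i} : Finset _) := by
    rw [disjoint_left]
    intro i hi hi'
    simp only [cdaNum, card_eq_zero, filter_eq_empty_iff] at h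
    exact h (mem_univ i) ⟨(mem_filter.mp hi').2, (mem_filter.mp hi).2⟩
  have h1 := card_union_of_disjoint hd
  rw [← filter_or, card_anti] at h1
  have h2 := card_filter_add_card_filter_not (s := (univ : Finset (Fin n)))
    (fun i => i < σ i ∨ σ.symm i < i)
  simp only [not_or, card_univ, Fintype.card_fin] at h2
  have h3 : #{i : Fin n | i < σ i} = excNum σ := rfl
  omega

/-- Fixed points lie at height zero, so a level step above the ground that opens and closes is a
double excedance; its weight `y = 0` removes it. The level steps left are fixed points and points
with `σ i < i < σ.symm i`, each of weight `l`. -/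
theorem sum_exc_inv_cda {R : Type*} [CommSemiring R] (n : ℕ) (u l q : R) :
    ∑ σ ∈ avoiders n ![3, 2, 1] with cdaNum σ = 0,
      u ^ excNum σ * l ^ (n - 2 * excNum σ) * q ^ invNum σ = pathSum u l l q n 0 := by
  have e := wordSum_stepWeight u l 0 l q n 0
  rw [zero_add] at e
  rw [← e, Nat.cast_zero, ← sum_avoiders_321_eq_wordSum _ (stepWeight_zero_of_nonpos _ _ _ _ _),
    sum_filter]
  refine sum_congr rfl fun σ hσ => ?_
  have hσ : Avoids σ ![3, 2, 1] := (mem_filter.mp hσ).2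
  split_ifs with hc
  · simp only [stepWeight, prod_mul_distrib]
    rw [prod_pow_wordHeight hσ, mul_comm]
    congr 1
    have h1 := card_rest hc
    have h2 : n - 2 * excNum σ = #{i : Fin n | ¬ i < σ i ∧ ¬ σ.symm i < i} := by omega
    rw [h2, excNum, ← prod_const, ← prod_const, prod_filter, prod_filter, ← prod_mul_distrib]
    refine prod_congr rfl fun i _ => ?_
    have hci : ¬ (σ.symm i < i ∧ i < σ i) := by
      simp only [cdaNum, card_eq_zero, filter_eq_empty_iff] at hc
      exact hc (mem_univ i)
    have hfix : σ i = i → σ.symm i = i := fun h => by rw [Equiv.symm_apply_eq, h]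
    have hfix' : σ.symm i = i → σ i = i := fun h => by rw [Equiv.symm_apply_eq] at h; exact h.symm
    rcases lt_trichotomy i (σ i) with hi | hi | hi
    · have h3 : i < σ.symm i := by
        rcases lt_trichotomy i (σ.symm i) with h | h | h
        · exact h
        · exact absurd (hfix' h.symm) hi.ne'
        · exact absurd ⟨h, hi⟩ hci
      simp [permWord, hi, hi.le, not_le.mpr h3]
    · have := wordHeight_permWord_fix hσ hi.symm
      simp [permWord, ← hi, hfix hi.symm, this]
    · have h0 := wordHeight_permWord_pos_of_not_wex hi
      by_cases h3 : σ.symm i < i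
      · simp [permWord, not_le.mpr hi, not_lt.mpr hi.le, not_le.mpr h0, h3, h3.le]
      · have h4 : ¬ σ.symm i ≤ i := fun h => h3 (lt_of_le_of_ne h fun e => hi.ne (hfix' e))
        simp [permWord, not_le.mpr hi, not_lt.mpr hi.le, not_le.mpr h0, h3, h4]
  · simp only [cdaNum, card_eq_zero, filter_eq_empty_iff, not_forall, not_not] at hc
    obtain ⟨i, -, h1, h2⟩ := hc
    have h1 : σ.symm i < i := h1
    refine (prod_eq_zero (mem_univ i) ?_).symm
    have h0 := wordHeight_permWord_pos_of_lt h1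
    simp [stepWeight, permWord, h1.le, h2.le, not_le.mpr h0]

/-! ### Identities between path sums -/

/-- Regrouping the steps of Dyck paths. -/
theorem pathSum_regroup {R : Type*} [CommSemiring R] (t q : R) (n h : ℕ) :
    pathSum (t * q) (t + q) (t + q) q n h =
      pathSum t t (t + 1) q n h + pathSum t t (t + 1) q n (h + 1) := by
  induction n generalizing h with
  | zero => simp [pathSum]
  | succ n ih =>
    cases h with
    | zero => simp only [pathSum, ih]; ring
    | succ h => simp only [pathSum, ih]; ring

theorem pathSum_succ_zero {R : Type*} [CommSemiring R] (t q : R) (n : ℕ) :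
    pathSum t t (t + 1) q (n + 1) 0 = t * pathSum (t * q) (t + q) (t + q) q n 0 := by
  rw [pathSum_regroup]; simp only [pathSum]; ring

/-- First-return decomposition. -/
theorem pathSum_first_return {R : Type*} [CommSemiring R] (t q : R) (n h : ℕ) :
    pathSum t 1 1 q n (h + 1) = ∑ p ∈ antidiagonal n, if p.2 = 0 then 0 else
      q ^ (p.1 + 1) * pathSum t 1 1 q p.1 h * pathSum t 1 1 q (p.2 - 1) 0 := by
  -- Before first reaching height 0 the path is one from `h`, lifted by one; each of its `p.1` steps
  -- and the closing down step gains a factor `q`. Lifting needs equal level weights on and above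
  -- the ground. The case `p.2 = 0` leaves no room for the down step.
  induction n generalizing h with
  | zero => simp [pathSum]
  | succ n ih =>
    rw [Nat.sum_antidiagonal_succ]
    cases h with
    | zero =>
      simp only [pathSum, ih]
      rw [mul_sum, mul_sum, ← sum_add_distrib, mul_add, mul_sum, add_comm]
      congr 1
      · simp
      · refine sum_congr rfl fun p _ => ?_
        split_ifs
        · simp
        · ring
    | succ h =>
      simp only [pathSum, ih]
      rw [mul_sum, mul_sum, ← sum_add_distrib, ← sum_add_distrib, mul_sum]
      simp only [Nat.succ_ne_zero, if_false, mul_zero, zero_mul, zero_add]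
      refine sum_congr rfl fun p _ => ?_
      split_ifs
      · simp
      · ring

/-- The path starts with a level step, or with an up step followed by its first return. -/
theorem pathSum_add_two {R : Type*} [CommSemiring R] (t q : R) (n : ℕ) :
    pathSum t 1 1 q (n + 2) 0 = pathSum t 1 1 q (n + 1) 0 + ∑ p ∈ antidiagonal n,
      t * q ^ (p.1 + 1) * pathSum t 1 1 q p.1 0 * pathSum t 1 1 q p.2 0 := by
  rw [pathSum, pathSum_first_return, Nat.sum_antidiagonal_succ', one_mul, add_comm]
  simp [mul_sum, mul_assoc]

/-! ### Permutations avoiding 231 without double descents -/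

/-- The word of a permutation of `{0, …, n - 1}`, continued by `n, n + 1, …`. -/
def toWord {n : ℕ} (σ : Equiv.Perm (Fin n)) (i : ℕ) : ℕ :=
  if h : i < n then σ ⟨i, h⟩ else i

/-- Words of the 231-avoiding permutations of `{0, …, n - 1}` without double descents. -/
structure IsWord231 (n : ℕ) (f : ℕ → ℕ) : Prop where
  inj : ∀ i j, f i = f j → i = j
  fix : ∀ i, n ≤ i → f i = i
  avoid : ∀ i j k, i < j → j < k → ¬ (f k < f i ∧ f i < f j)
  noDouble : ∀ i, ¬ (f (i + 2) < f (i + 1) ∧ f (i + 1) < f i)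

theorem toWord_of_lt {n : ℕ} (σ : Equiv.Perm (Fin n)) (i : Fin n) : toWord σ i = σ i := by
  simp [toWord]

theorem toWord_of_le {n : ℕ} (σ : Equiv.Perm (Fin n)) {i : ℕ} (h : n ≤ i) : toWord σ i = i := by
  simp [toWord, not_lt.mpr h]

theorem toWord_lt_iff {n : ℕ} (σ : Equiv.Perm (Fin n)) {i : ℕ} : toWord σ i < n ↔ i < n := by
  unfold toWord
  split_ifs with h <;> simp [h]

theorem toWord_injective (n : ℕ) : Function.Injective (toWord (n := n)) := by
  intro σ τ h
  ext i
  rw [← toWord_of_lt, ← toWord_of_lt, h]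

theorem toWord_inj {n : ℕ} (σ : Equiv.Perm (Fin n)) (i j : ℕ) (h : toWord σ i = toWord σ j) :
    i = j := by
  have hi := toWord_lt_iff σ (i := i)
  have hj := toWord_lt_iff σ (i := j)
  by_cases h1 : i < n
  · have h2 : j < n := by rw [← hj, ← h, hi]; exact h1
    have e1 := toWord_of_lt σ ⟨i, h1⟩
    have e2 := toWord_of_lt σ ⟨j, h2⟩
    simp only at e1 e2
    rw [e1, e2] at h
    have := σ.injective (Fin.ext h)
    simpa using this
  · have h2 : ¬ j < n := by rw [← hj, ← h, hi]; exact h1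
    rwa [toWord_of_le σ (not_lt.mp h1), toWord_of_le σ (not_lt.mp h2)] at h

/-- The boundary values `0` and `⊤` prevent the first and the last letter from being double
descents, so only interior triples matter. -/
theorem lddNum_eq_zero_iff {n : ℕ} (σ : Equiv.Perm (Fin n)) :
    lddNum σ = 0 ↔ ∀ i j k : Fin n, (j : ℕ) = i + 1 → (k : ℕ) = j + 1 →
      ¬ (σ k < σ j ∧ σ j < σ i) := by
  rw [lddNum, card_eq_zero, filter_eq_empty_iff]
  constructor
  · intro h i j k hj hk ⟨h1, h2⟩
    refine h (mem_Icc.mpr ⟨?_, j.isLt⟩ : (j : ℕ) + 1 ∈ Icc 1 n) ?_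
    · omega
    have ei : padded σ 0 ⊤ j = ((σ i : ℕ) + 1 : ℕ) := by
      have : (⟨(j : ℕ) - 1, by omega⟩ : Fin n) = i := Fin.ext (by simp [hj])
      simp only [padded]
      rw [if_neg (by omega), dif_pos (by omega), this]
    have ej : padded σ 0 ⊤ (j + 1) = ((σ j : ℕ) + 1 : ℕ) := by simp [padded]
    have ek : padded σ 0 ⊤ (j + 1 + 1) = ((σ k : ℕ) + 1 : ℕ) := by simp [padded, ← hk]
    rw [Nat.add_sub_cancel, ei, ej, ek, Nat.cast_lt, Nat.cast_lt]
    exact ⟨Nat.succ_lt_succ h2, Nat.succ_lt_succ h1⟩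
  · rintro h m hm ⟨h1, h2⟩
    obtain ⟨hm1, hm2⟩ := mem_Icc.mp hm
    obtain ⟨m, rfl⟩ : ∃ m', m = m' + 1 := ⟨m - 1, by omega⟩
    rw [Nat.add_sub_cancel] at h1
    have hm0 : m ≠ 0 := by rintro rfl; simp [padded] at h1
    have hmn : m + 1 < n := by
      by_contra hc
      have : padded σ 0 ⊤ (m + 1 + 1) = ⊤ := by simp [padded, hc]
      rw [this] at h2
      exact not_top_lt h2
    have e0 : padded σ 0 ⊤ m = ((σ ⟨m - 1, by omega⟩ : ℕ) + 1 : ℕ) := by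
      simp only [padded]
      rw [if_neg hm0, dif_pos (by omega)]
    have e1 : padded σ 0 ⊤ (m + 1) = ((σ ⟨m, by omega⟩ : ℕ) + 1 : ℕ) := by
      simp [padded, show m < n by omega]
    have e2 : padded σ 0 ⊤ (m + 1 + 1) = ((σ ⟨m + 1, hmn⟩ : ℕ) + 1 : ℕ) := by simp [padded, hmn]
    rw [e0, e1, Nat.cast_lt] at h1
    rw [e1, e2, Nat.cast_lt] at h2
    exact h ⟨m - 1, by omega⟩ ⟨m, by omega⟩ ⟨m + 1, hmn⟩ (by
      simp only; omega) rfl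
      ⟨Nat.lt_of_succ_lt_succ h2, Nat.lt_of_succ_lt_succ h1⟩

/-- The appended tail is increasing and exceeds all letters of `σ`, so it creates neither a 231
pattern nor a double descent. -/
theorem isWord231_toWord_iff {n : ℕ} (σ : Equiv.Perm (Fin n)) :
    IsWord231 n (toWord σ) ↔ Avoids σ ![2, 3, 1] ∧ lddNum σ = 0 := by
  rw [avoids_231_iff, lddNum_eq_zero_iff]
  constructor
  · intro h
    constructor
    · intro i j k hij hjk
      have := h.avoid i j k hij hjk
      simpa only [toWord_of_lt, ← Fin.lt_def] using this
    · intro i j k hj hk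
      have := h.noDouble i
      rw [show (i : ℕ) + 2 = k by omega, ← hj] at this
      simpa only [toWord_of_lt, ← Fin.lt_def] using this
  · rintro ⟨h1, h2⟩
    refine ⟨toWord_inj σ, fun i hi => toWord_of_le σ hi, fun i j k hij hjk => ?_, fun i => ?_⟩
    · rintro ⟨a, b⟩
      by_cases hk : k < n
      · refine h1 ⟨i, by omega⟩ ⟨j, by omega⟩ ⟨k, hk⟩ hij hjk ?_
        simp only [Fin.lt_def, ← toWord_of_lt]
        exact ⟨a, b⟩
      · rw [toWord_of_le σ (not_lt.mp hk)] at a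
        have hi := toWord_lt_iff σ (i := i)
        have hj := toWord_lt_iff σ (i := j)
        by_cases hin : i < n
        · have := hi.mpr hin; omega
        · rw [toWord_of_le σ (not_lt.mp hin)] at a; omega
    · rintro ⟨a, b⟩
      by_cases hk : i + 2 < n
      · refine h2 ⟨i, by omega⟩ ⟨i + 1, by omega⟩ ⟨i + 2, hk⟩ rfl rfl ?_
        simp only [Fin.lt_def, ← toWord_of_lt]
        exact ⟨a, b⟩
      · rw [toWord_of_le σ (not_lt.mp hk)] at a
        have hj := toWord_lt_iff σ (i := i + 1)
        by_cases hin : i + 1 < n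
        · have := hj.mpr hin; omega
        · rw [toWord_of_le σ (not_lt.mp hin)] at a; omega

namespace IsWord231
variable {n : ℕ} {f : ℕ → ℕ}

theorem lt_iff (h : IsWord231 n f) {i : ℕ} : f i < n ↔ i < n := by
  constructor
  · intro hi
    by_contra hc
    have := h.fix i (not_lt.mp hc)
    omega
  · intro hi
    by_contra hc
    have := h.inj _ _ (h.fix (f i) (not_lt.mp hc))
    omega

theorem image_range (h : IsWord231 n f) : (range n).image f = range n := by
  refine eq_of_subset_of_card_le (fun x hx => ?_) ?_
  · obtain ⟨i, hi, rfl⟩ := mem_image.mp hx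
    exact mem_range.mpr (h.lt_iff.mpr (mem_range.mp hi))
  · rw [card_image_of_injective _ (fun i j => h.inj i j)]

theorem exists_eq (h : IsWord231 n f) (y : ℕ) : ∃ x, f x = y := by
  by_cases hy : y < n
  · rw [← mem_range, ← h.image_range] at hy
    obtain ⟨x, -, hx⟩ := mem_image.mp hy
    exact ⟨x, hx⟩
  · exact ⟨y, h.fix y (not_lt.mp hy)⟩

theorem exists_toWord_eq (h : IsWord231 n f) : ∃ σ : Equiv.Perm (Fin n), toWord σ = f := by
  let g : Fin n → Fin n := fun i => ⟨f i, h.lt_iff.mpr i.isLt⟩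
  have hg : Function.Injective g := fun i j hij => Fin.ext (h.inj _ _ (Fin.mk.inj_iff.mp hij))
  refine ⟨Equiv.ofBijective g (Finite.injective_iff_bijective.mp hg), funext fun i => ?_⟩
  by_cases hi : i < n
  · simp [toWord, hi, g]
  · simp [toWord, hi, h.fix i (not_lt.mp hi)]

end IsWord231

open Classical in
/-- The finite set of words of length `n` as in `IsWord231`. -/
noncomputable def words231 (n : ℕ) : Finset (ℕ → ℕ) :=
  {f ∈ (univ : Finset (Equiv.Perm (Fin n))).image toWord | IsWord231 n f}

theorem mem_words231 {n : ℕ} {f : ℕ → ℕ} : f ∈ words231 n ↔ IsWord231 n f := by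
  simp only [words231, mem_filter, mem_image, mem_univ, true_and, and_iff_right_iff_imp]
  exact fun h => h.exists_toWord_eq

/-! ### Decomposition of the words by their first letter -/

/-- Weight of two consecutive letters of a word. -/
def pairWeight {R : Type*} [CommSemiring R] (t q : R) (a b : ℕ) : R :=
  if b < a then t * q ^ (a - b) else 1

theorem pairWeight_add {R : Type*} [CommSemiring R] (t q : R) (a b c : ℕ) :
    pairWeight t q (a + c) (b + c) = pairWeight t q a b := by
  simp [pairWeight, Nat.add_sub_add_right]

theorem pairWeight_of_le {R : Type*} [CommSemiring R] (t q : R) {a b : ℕ} (h : a ≤ b) :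
    pairWeight t q a b = 1 := by
  simp [pairWeight, not_lt.mpr h]

/-- Weighted sum over the words of `words231 n`. -/
noncomputable def wordSum231 {R : Type*} [CommSemiring R] (t q : R) (n : ℕ) : R :=
  ∑ f ∈ words231 n, ∏ i ∈ range n, pairWeight t q (f i) (f (i + 1))

/-- The word `0 R`. -/
def levelWord (r : ℕ → ℕ) : ℕ → ℕ
  | 0 => 0
  | i + 1 => r i + 1

/-- The word `(a + 1) 0 L R`, where `L` has length `a`. -/
def archWord (a : ℕ) (l r : ℕ → ℕ) : ℕ → ℕ
  | 0 => a + 1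
  | 1 => 0
  | i + 2 => if i < a then l i + 1 else r (i - a) + (a + 2)

theorem isWord231_levelWord {n : ℕ} {r : ℕ → ℕ} (h : IsWord231 n r) :
    IsWord231 (n + 1) (levelWord r) := by
  refine ⟨?_, ?_, ?_, ?_⟩
  · rintro (_ | i) (_ | j) hij
    · rfl
    · simp [levelWord] at hij
    · simp [levelWord] at hij
    · simp only [levelWord, Nat.add_right_cancel_iff] at hij
      rw [h.inj _ _ hij]
  · rintro (_ | i) hi
    · rfl
    · simp only [levelWord, h.fix i (by omega)]
  · rintro (_ | i) (_ | j) (_ | k) hij hjk <;> simp only [levelWord] <;> try omega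
    have := h.avoid i j k (by omega) (by omega)
    omega
  · rintro (_ | i)
    · simp [levelWord]
    · have := h.noDouble i
      simp only [levelWord]
      omega

theorem isWord231_of_levelWord {n : ℕ} {f : ℕ → ℕ} (h : IsWord231 (n + 1) f) (h0 : f 0 = 0) :
    IsWord231 n (fun i => f (i + 1) - 1) ∧ levelWord (fun i => f (i + 1) - 1) = f := by
  have hpos : ∀ i, 0 < f (i + 1) := fun i => by
    by_contra hc
    have := h.inj (i + 1) 0 (by omega)
    omega
  refine ⟨⟨?_, ?_, ?_, ?_⟩, ?_⟩
  · intro i j hij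
    have := hpos i
    have := hpos j
    have := h.inj (i + 1) (j + 1) (by omega)
    omega
  · intro i hi
    have := h.fix (i + 1) (by omega)
    omega
  · intro i j k hij hjk
    have := h.avoid (i + 1) (j + 1) (k + 1) (by omega) (by omega)
    have := hpos i
    have := hpos j
    have := hpos k
    omega
  · intro i
    have := h.noDouble (i + 1)
    have := hpos i
    have := hpos (i + 1)
    have := hpos (i + 2)
    simp only [show i + 1 + 1 = i + 2 by rfl, show i + 1 + 2 = i + 2 + 1 by rfl] at *
    omega
  · funext i
    cases i with
    | zero => exact h0.symm
    | succ i => have := hpos i; simp only [levelWord]; omega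

/-- Past the initial letters `a + 1` and `0`, the letters of `L` are at most `a` and those of `R` at
least `a + 2`. Hence no forbidden configuration uses an initial letter or meets both blocks. -/
theorem isWord231_archWord {a b : ℕ} {l r : ℕ → ℕ} (hl : IsWord231 a l) (hr : IsWord231 b r) :
    IsWord231 (a + b + 2) (archWord a l r) := by
  have hla : ∀ i, i < a → l i < a := fun i => hl.lt_iff.mpr
  refine ⟨?_, ?_, ?_, ?_⟩
  · rintro (_ | _ | i) (_ | _ | j) hij <;> simp only [archWord] at hij <;> try omega
    · split_ifs at hij with h1
      · have := hla _ h1; omega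
      · omega
    · split_ifs at hij
    · split_ifs at hij with h1
      · have := hla _ h1; omega
      · omega
    · split_ifs at hij
    · split_ifs at hij with h1 h2 h2
      · have := hl.inj i j (by omega); omega
      · have := hla _ h1; omega
      · have := hla _ h2; omega
      · have := hr.inj (i - a) (j - a) (by omega); omega
  · rintro (_ | _ | i) hi
    · omega
    · omega
    · have := hr.fix (i - a) (by omega)
      simp only [archWord, this]
      split_ifs <;> omega
  · have key : ∀ i : ℕ, (i < a → archWord a l r (i + 1 + 1) ≤ a) ∧
        (a ≤ i → a + 2 ≤ archWord a l r (i + 1 + 1)) := fun i => by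
      simp only [archWord]
      constructor
      · intro h; have := hla i h; rw [if_pos h]; omega
      · intro h; rw [if_neg (by omega)]; omega
    rintro (_ | _ | i) (_ | _ | j) (_ | _ | k) hij hjk <;> try omega
    · have h0 : archWord a l r 0 = a + 1 := rfl
      have h1 : archWord a l r 1 = 0 := rfl
      simp only [zero_add, h0, h1]; omega
    · have h0 : archWord a l r 0 = a + 1 := rfl
      have hj := key j
      have hk := key k
      rw [h0]
      by_cases h1 : j < a
      · have := hj.1 h1; omega
      · have := hk.2 (by omega); omega
    · have h1 : archWord a l r 1 = 0 := rfl
      simp only [zero_add, h1]; omega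
    · have hi := key i
      have hj := key j
      have hk := key k
      by_cases h1 : k < a
      · have := hl.avoid i j k (by omega) (by omega)
        simp only [archWord, h1, show i < a by omega, show j < a by omega, if_true]
        omega
      · by_cases h2 : i < a
        · have := hi.1 h2
          have := hk.2 (by omega)
          omega
        · have := hr.avoid (i - a) (j - a) (k - a) (by omega) (by omega)
          simp only [archWord, h1, h2, show ¬ j < a by omega, if_false]
          omega
  · rintro (_ | _ | i)
    · have h1 : archWord a l r 1 = 0 := rfl
      simp only [zero_add, h1]; omega
    · have h1 : archWord a l r 1 = 0 := rfl
      simp only [zero_add, h1]; omega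
    · have e : i + 1 - a = if i < a then 0 else i - a + 1 := by split_ifs <;> omega
      simp only [archWord]
      by_cases h1 : i + 2 < a
      · have := hl.noDouble i
        simp only [h1, show i < a by omega, show i + 1 < a by omega, if_true]
        omega
      · by_cases h2 : i < a
        · have := hla i h2
          by_cases h3 : i + 1 < a
          · have := hla _ h3
            simp only [h1, h3, if_true, if_false]; omega
          · simp only [h2, h3, if_true, if_false]; omega
        · have := hr.noDouble (i - a)
          simp only [h1, h2, show ¬ i + 1 < a by omega, if_false,
            show i + 1 - a = i - a + 1 by omega, show i + 2 - a = i - a + 2 by omega]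
          omega

/-- Suppose `0` sits at a position `p ≥ 2`. Avoidance at `0, 1, p` forces `f 1 < f 0`, the absence
of double descents forces `f 1 < f 2`, and then `1, 2, p` is a 231 pattern. -/
theorem IsWord231.apply_one {n : ℕ} {f : ℕ → ℕ} (h : IsWord231 n f) (h0 : f 0 ≠ 0) : f 1 = 0 := by
  obtain ⟨p, hp⟩ := h.exists_eq 0
  have hp0 : p ≠ 0 := by rintro rfl; exact h0 hp
  by_contra h1
  have hp1 : p ≠ 1 := by rintro rfl; exact h1 hp
  have a1 := h.avoid 0 1 p (by omega) (by omega)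
  have a2 : f 0 ≠ f 1 := fun e => by have := h.inj _ _ e; omega
  have a3 := h.noDouble 0
  simp only [zero_add] at a3
  have a4 : f 1 ≠ f 2 := fun e => by have := h.inj _ _ e; omega
  have hp2 : p ≠ 2 := by rintro rfl; omega
  have a5 := h.avoid 1 2 p (by omega) (by omega)
  omega

/-- A letter above `a + 1` at position `i + 2` allows no later letter below the first one. All `a +
2` values up to `a + 1` would then occupy the first `i + 2 < a + 2` positions. -/
theorem IsWord231.arch_left {n a : ℕ} {f : ℕ → ℕ} (h : IsWord231 n f) (h0 : f 0 = a + 1)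
    {i : ℕ} (hi : i < a) : f (i + 2) ≤ a := by
  by_contra hc
  have hne : f (i + 2) ≠ a + 1 := fun e => by
    have := h.inj (i + 2) 0 (by omega); omega
  have hsub : range (a + 2) ⊆ (range (i + 2)).image f := by
    intro y hy
    rw [mem_range] at hy
    obtain ⟨x, hx⟩ := h.exists_eq y
    refine mem_image.mpr ⟨x, ?_, hx⟩
    rw [mem_range]
    by_contra hxi
    rcases (not_lt.mp hxi).eq_or_lt with e | hlt
    · rw [← e] at hx; omega
    · have h1 := h.avoid 0 (i + 2) x (by omega) hlt
      have h2 : f x ≠ a + 1 := fun e => by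
        have := h.inj x 0 (by omega); omega
      omega
  have h1 := (card_le_card hsub).trans card_image_le
  simp only [card_range] at h1
  omega

/-- A letter below `a + 1` at position `i + 2` forces all letters before it to be at most `a + 1`.
That gives `i + 3` distinct letters among `a + 2` values. -/
theorem IsWord231.arch_right {n a : ℕ} {f : ℕ → ℕ} (h : IsWord231 n f) (h0 : f 0 = a + 1)
    {i : ℕ} (hi : a ≤ i) : a + 2 ≤ f (i + 2) := by
  by_contra hc
  have hne : f (i + 2) ≠ a + 1 := fun e => by
    have := h.inj (i + 2) 0 (by omega); omega
  have hsub : (range (i + 3)).image f ⊆ range (a + 2) := by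
    intro y hy
    obtain ⟨x, hx, rfl⟩ := mem_image.mp hy
    rw [mem_range] at hx ⊢
    rcases Nat.eq_zero_or_pos x with rfl | hpos
    · omega
    · rcases (Nat.le_of_lt_succ hx).eq_or_lt with rfl | hlt
      · omega
      · have := h.avoid 0 x (i + 2) hpos hlt
        omega
  have h1 := card_le_card hsub
  rw [card_image_of_injective _ (fun i j => h.inj i j)] at h1
  simp only [card_range] at h1
  omega

/-- The block bounds `arch_left` and `arch_right` make the subtractions exact. The left word is cut
off at `a` and continued by the identity, because the letters of `f` from there on belong to `R`. -/
theorem IsWord231.arch_decomposition {a b : ℕ} {f : ℕ → ℕ} (h : IsWord231 (a + b + 2) f)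
    (h0 : f 0 = a + 1) :
    IsWord231 a (fun i => if i < a then f (i + 2) - 1 else i) ∧
      IsWord231 b (fun i => f (i + a + 2) - (a + 2)) ∧
      archWord a (fun i => if i < a then f (i + 2) - 1 else i)
        (fun i => f (i + a + 2) - (a + 2)) = f := by
  have hone := h.apply_one (by omega)
  have hL : ∀ i, i < a → f (i + 2) ≤ a := fun i => h.arch_left h0
  have hR : ∀ i, a + 2 ≤ f (i + a + 2) := fun i => h.arch_right h0 (by omega)
  have hpos : ∀ i, 0 < f (i + 2) := fun i => by
    by_contra hc
    have := h.inj (i + 2) 1 (by omega)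
    omega
  refine ⟨⟨?_, ?_, ?_, ?_⟩, ⟨?_, ?_, ?_, ?_⟩, ?_⟩
  · intro i j hij
    have := hpos i
    have := hpos j
    have h1 := h.inj (i + 2) (j + 2)
    have := hL i
    have := hL j
    split_ifs at hij <;> omega
  · intro i hi
    exact if_neg (by omega)
  · intro i j k hij hjk
    have := hpos i
    have := hpos j
    have := hpos k
    have := hL i
    have := hL j
    have := h.avoid (i + 2) (j + 2) (k + 2) (by omega) (by omega)
    split_ifs <;> omega
  · intro i
    have h1 := hpos i
    have h2 := hpos (i + 1)
    have h3 := hpos (i + 2)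
    have h4 := hL i
    have h5 := hL (i + 1)
    have h6 := h.noDouble (i + 2)
    have e : i + 2 + 1 = i + 1 + 2 := rfl
    rw [e] at h6
    split_ifs <;> omega
  · intro i j hij
    have h1 := hR i
    have h2 := hR j
    have := h.inj (i + a + 2) (j + a + 2) (by omega)
    omega
  · intro i hi
    have := h.fix (i + a + 2) (by omega)
    omega
  · intro i j k hij hjk
    have h1 := hR i
    have h2 := hR j
    have h3 := hR k
    have := h.avoid (i + a + 2) (j + a + 2) (k + a + 2) (by omega) (by omega)
    omega
  · intro i
    have h1 := hR i
    have h2 := hR (i + 1)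
    have h3 := hR (i + 2)
    have h4 := h.noDouble (i + a + 2)
    rw [show i + a + 2 + 2 = i + 2 + a + 2 by omega,
      show i + a + 2 + 1 = i + 1 + a + 2 by omega] at h4
    omega
  · funext i
    match i with
    | 0 => exact h0.symm
    | 1 => exact hone.symm
    | i + 2 =>
      have h1 := hpos i
      simp only [archWord]
      split_ifs with h2
      · omega
      · have h3 := hR (i - a)
        rw [show i - a + a + 2 = i + 2 by omega] at h3 ⊢
        omega

theorem prod_levelWord {R : Type*} [CommSemiring R] (t q : R) (n : ℕ) (r : ℕ → ℕ) :
    ∏ i ∈ range (n + 1), pairWeight t q (levelWord r i) (levelWord r (i + 1)) =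
      ∏ i ∈ range n, pairWeight t q (r i) (r (i + 1)) := by
  rw [prod_range_succ']
  have : pairWeight t q (levelWord r 0) (levelWord r (0 + 1)) = 1 :=
    pairWeight_of_le _ _ (Nat.zero_le _)
  rw [this, mul_one]
  exact prod_congr rfl fun i _ => pairWeight_add t q _ _ 1

theorem prod_archWord {R : Type*} [CommSemiring R] (t q : R) {a : ℕ} (b : ℕ) {l : ℕ → ℕ}
    (hl : IsWord231 a l) (r : ℕ → ℕ) :
    ∏ i ∈ range (a + b + 2), pairWeight t q (archWord a l r i) (archWord a l r (i + 1)) =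
      t * q ^ (a + 1) * (∏ i ∈ range a, pairWeight t q (l i) (l (i + 1))) *
        ∏ i ∈ range b, pairWeight t q (r i) (r (i + 1)) := by
  rw [prod_range_succ', prod_range_succ', prod_range_add]
  have h0 : pairWeight t q (archWord a l r 0) (archWord a l r (0 + 1)) = t * q ^ (a + 1) := by
    simp [pairWeight, archWord]
  have h1 : pairWeight t q (archWord a l r (0 + 1)) (archWord a l r (0 + 1 + 1)) = 1 :=
    pairWeight_of_le _ _ (Nat.zero_le _)
  have h2 : ∏ i ∈ range a, pairWeight t q (archWord a l r (i + 1 + 1))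
      (archWord a l r (i + 1 + 1 + 1)) = ∏ i ∈ range a, pairWeight t q (l i) (l (i + 1)) := by
    refine prod_congr rfl fun i hi => ?_
    have hi := mem_range.mp hi
    have hla := hl.lt_iff.mpr hi
    simp only [archWord, if_pos hi]
    split_ifs with h3
    · exact pairWeight_add t q _ _ 1
    -- Here `i` is the last position of `L`: it is followed by `R` on one side and by the identity
    -- tail of `l` on the other, an ascent in both cases.
    · have := hl.fix (i + 1) (by omega)
      rw [pairWeight_of_le _ _ (by omega), pairWeight_of_le _ _ (by omega)]
  have h3 : ∏ i ∈ range b, pairWeight t q (archWord a l r (a + i + 1 + 1))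
      (archWord a l r (a + i + 1 + 1 + 1)) = ∏ i ∈ range b, pairWeight t q (r i) (r (i + 1)) := by
    refine prod_congr rfl fun i _ => ?_
    simp only [archWord, show ¬ a + i < a by omega, show ¬ a + i + 1 < a by omega, if_false,
      show a + i - a = i by omega, show a + i + 1 - a = i + 1 by omega]
    exact pairWeight_add t q _ _ _
  rw [h0, h1, h2, h3]
  ring

theorem sum_words231_level {R : Type*} [CommSemiring R] (t q : R) (n : ℕ) :
    ∑ f ∈ words231 (n + 1) with f 0 = 0, ∏ i ∈ range (n + 1), pairWeight t q (f i) (f (i + 1)) =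
      wordSum231 t q n := by
  refine sum_nbij' (fun f i => f (i + 1) - 1) levelWord ?_ ?_ ?_ ?_ ?_
  · intro f hf
    rw [mem_filter, mem_words231] at hf
    exact mem_words231.mpr (isWord231_of_levelWord hf.1 hf.2).1
  · intro r hr
    rw [mem_filter, mem_words231]
    exact ⟨isWord231_levelWord (mem_words231.mp hr), rfl⟩
  · intro f hf
    rw [mem_filter, mem_words231] at hf
    exact (isWord231_of_levelWord hf.1 hf.2).2
  · intro r _
    funext i
    simp [levelWord]
  · intro f hf
    rw [mem_filter, mem_words231] at hf
    conv_lhs => rw [← (isWord231_of_levelWord hf.1 hf.2).2]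
    exact prod_levelWord t q n _

theorem sum_words231_arch {R : Type*} [CommSemiring R] (t q : R) (a b : ℕ) :
    ∑ f ∈ words231 (a + b + 2) with f 0 = a + 1,
      ∏ i ∈ range (a + b + 2), pairWeight t q (f i) (f (i + 1)) =
      t * q ^ (a + 1) * wordSum231 t q a * wordSum231 t q b := by
  simp only [wordSum231]
  rw [mul_assoc, sum_mul_sum, ← sum_product', mul_sum]
  refine sum_nbij' (fun f => (fun i => if i < a then f (i + 2) - 1 else i,
    fun i => f (i + a + 2) - (a + 2))) (fun p => archWord a p.1 p.2) ?_ ?_ ?_ ?_ ?_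
  · intro f hf
    rw [mem_filter, mem_words231] at hf
    have := hf.1.arch_decomposition hf.2
    exact mem_product.mpr ⟨mem_words231.mpr this.1, mem_words231.mpr this.2.1⟩
  · intro p hp
    rw [mem_product, mem_words231, mem_words231] at hp
    rw [mem_filter, mem_words231]
    exact ⟨isWord231_archWord hp.1 hp.2, rfl⟩
  · intro f hf
    rw [mem_filter, mem_words231] at hf
    exact (hf.1.arch_decomposition hf.2).2.2
  · intro p hp
    rw [mem_product, mem_words231, mem_words231] at hp
    refine Prod.ext (funext fun i => ?_) (funext fun i => ?_)
    · have := hp.1.fix i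
      simp only [archWord]
      split_ifs
      · simp
      · exact (this (by omega)).symm
    · simp only [archWord]
      rw [if_neg (by omega)]
      simp
  · intro f hf
    rw [mem_filter, mem_words231] at hf
    obtain ⟨h1, h2, h3⟩ := hf.1.arch_decomposition hf.2
    conv_lhs => rw [← h3]
    rw [prod_archWord t q b h1, mul_assoc]

theorem wordSum231_add_two {R : Type*} [CommSemiring R] (t q : R) (n : ℕ) :
    wordSum231 t q (n + 2) = wordSum231 t q (n + 1) +
      ∑ p ∈ antidiagonal n, t * q ^ (p.1 + 1) * wordSum231 t q p.1 * wordSum231 t q p.2 := by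
  rw [wordSum231, ← sum_filter_add_sum_filter_not _ (fun f => f 0 = 0), sum_words231_level]
  congr 1
  -- A nonzero first letter `a + 1` determines the lengths `a` and `b = n - a` of the two blocks.
  rw [← sum_fiberwise_of_maps_to (t := antidiagonal n) (g := fun f => (f 0 - 1, n + 1 - f 0))]
  · refine sum_congr rfl fun p hp => ?_
    have hp := HasAntidiagonal.mem_antidiagonal.mp hp
    rw [← hp, ← sum_words231_arch, filter_filter]
    refine sum_congr (filter_congr fun f hf => ?_) fun _ _ => rfl
    have := (mem_words231.mp hf).lt_iff (i := 0)
    rw [Prod.ext_iff]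
    dsimp only
    omega
  · intro f hf
    rw [mem_filter, mem_words231] at hf
    have := hf.1.lt_iff (i := 0)
    rw [HasAntidiagonal.mem_antidiagonal]
    omega

theorem words231_zero : words231 0 = {id} := by
  ext f
  rw [mem_words231, mem_singleton]
  constructor
  · exact fun h => funext fun i => h.fix i (Nat.zero_le i)
  · rintro rfl
    exact ⟨fun _ _ h => h, fun _ _ => rfl, fun i j k _ _ => by simp only [id]; omega,
      fun i => by simp only [id]; omega⟩

theorem wordSum231_zero {R : Type*} [CommSemiring R] (t q : R) : wordSum231 t q 0 = 1 := by
  simp [wordSum231, words231_zero]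

theorem wordSum231_one {R : Type*} [CommSemiring R] (t q : R) : wordSum231 t q 1 = 1 := by
  have h := sum_words231_level t q 0
  rw [wordSum231_zero, filter_true_of_mem] at h
  · exact h
  · intro f hf
    have := (mem_words231.mp hf).lt_iff (i := 0)
    omega

theorem wordSum231_eq_pathSum {R : Type*} [CommSemiring R] (t q : R) (n : ℕ) :
    wordSum231 t q n = pathSum t 1 1 q n 0 := by
  induction n using Nat.strong_induction_on with
  | _ n ih =>
    match n with
    | 0 => simp [wordSum231_zero, pathSum]
    | 1 => simp [wordSum231_one, pathSum]
    | n + 2 =>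
      rw [wordSum231_add_two, pathSum_add_two, ih (n + 1) (by omega)]
      congr 1
      refine sum_congr rfl fun p hp => ?_
      have := HasAntidiagonal.mem_antidiagonal.mp hp
      rw [ih p.1 (by omega), ih p.2 (by omega)]

/-! ### Descents and 31-2 patterns read off the word -/

section
variable {n : ℕ}

theorem desNum_eq_card (σ : Equiv.Perm (Fin n)) :
    desNum σ = #{i : Fin n | toWord σ (i + 1) < toWord σ i} := by
  rw [desNum, card_filter, card_filter, Fintype.sum_prod_type]
  refine sum_congr rfl fun i _ => ?_
  by_cases hi : (i : ℕ) + 1 < n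
  · rw [Fintype.sum_eq_single ⟨i + 1, hi⟩]
    · have h := toWord_of_lt σ ⟨i + 1, hi⟩
      simp only at h
      simp only [h, toWord_of_lt, true_and, Fin.lt_def]
    · intro j hj
      exact if_neg fun h => hj (Fin.ext h.1)
  · rw [if_neg]
    · refine sum_eq_zero fun j _ => if_neg fun h => ?_
      have := j.isLt
      dsimp only at h
      omega
    · rw [toWord_of_le σ (not_lt.mp hi), toWord_of_lt]
      have := (σ i).isLt
      omega

/-- At a descent, avoidance of 231 places every value strictly between the two letters to the right
of them. The 31-2 patterns at this descent therefore number the drop minus one, and the descent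
itself supplies the missing one. At an ascent the truncated difference vanishes. -/
theorem v31_2_add_desNum {σ : Equiv.Perm (Fin n)} (h : Avoids σ ![2, 3, 1]) :
    v31_2 σ + desNum σ = ∑ i : Fin n, (toWord σ i - toWord σ (i + 1)) := by
  rw [avoids_231_iff] at h
  rw [desNum_eq_card, v31_2, card_filter, card_filter, Fintype.sum_prod_type, ← sum_add_distrib]
  refine sum_congr rfl fun i _ => ?_
  rw [Fintype.sum_prod_type]
  by_cases hi : (i : ℕ) + 1 < n
  · rw [Fintype.sum_eq_single ⟨i + 1, hi⟩, ← card_filter]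
    · have e := toWord_of_lt σ ⟨i + 1, hi⟩
      simp only at e
      have hset : ({k : Fin n | (i : ℕ) + 1 = i + 1 ∧ (⟨i + 1, hi⟩ : Fin n) < k ∧
          σ ⟨i + 1, hi⟩ < σ k ∧ σ k < σ i} : Finset (Fin n)).map σ.toEmbedding =
          Ioo (σ ⟨i + 1, hi⟩) (σ i) := by
        ext x
        obtain ⟨k, rfl⟩ := σ.surjective x
        simp only [mem_map, mem_filter, mem_univ, true_and, Equiv.coe_toEmbedding,
          EmbeddingLike.apply_eq_iff_eq, exists_eq_right, mem_Ioo, and_iff_right_iff_imp]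
        rintro ⟨h1, h2⟩
        by_contra hc
        rcases lt_trichotomy k i with hk | hk | hk
        · exact h k i ⟨i + 1, hi⟩ hk (Fin.lt_def.mpr (Nat.lt_succ_self _)) ⟨h1, h2⟩
        · subst hk; exact lt_irrefl _ h2
        · rcases (not_lt.mp hc).eq_or_lt with e' | hlt
          · rw [e'] at h1; exact lt_irrefl _ h1
          · simp only [Fin.lt_def] at hk hlt; omega
      have hcard := congrArg card hset
      rw [card_map, Fin.card_Ioo] at hcard
      rw [hcard, e, toWord_of_lt]
      split_ifs <;> omega
    · intro j hj
      exact sum_eq_zero fun k _ => if_neg fun h => hj (Fin.ext h.1)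
  -- At the last position the next letter of the continued word is `n`, so both sides are zero.
  · rw [toWord_of_le σ (not_lt.mp hi), toWord_of_lt]
    have := (σ i).isLt
    rw [sum_eq_zero, if_neg (by omega)]
    · omega
    · refine fun j _ => sum_eq_zero fun k _ => if_neg fun h => ?_
      have := j.isLt
      dsimp only at h
      omega

theorem sum_des_v31_2 {R : Type*} [CommSemiring R] (n : ℕ) (t q : R) :
    ∑ σ ∈ avoiders n ![2, 3, 1] with lddNum σ = 0,
      t ^ desNum σ * q ^ (v31_2 σ + desNum σ) = pathSum t 1 1 q n 0 := by
  rw [← wordSum231_eq_pathSum, wordSum231]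
  refine sum_nbij toWord ?_ (fun _ _ _ _ h => toWord_injective n h) ?_ ?_
  · intro σ hσ
    rw [mem_filter, avoiders, mem_filter] at hσ
    exact mem_words231.mpr ((isWord231_toWord_iff σ).mpr ⟨hσ.1.2, hσ.2⟩)
  · intro f hf
    have hf := mem_words231.mp (mem_coe.mp hf)
    obtain ⟨σ, rfl⟩ := hf.exists_toWord_eq
    have := (isWord231_toWord_iff σ).mp hf
    refine ⟨σ, ?_, rfl⟩
    rw [mem_coe, mem_filter, avoiders, mem_filter]
    exact ⟨⟨mem_univ _, this.1⟩, this.2⟩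
  · intro σ hσ
    rw [mem_filter, avoiders, mem_filter] at hσ
    rw [v31_2_add_desNum hσ.1.2, desNum_eq_card, prod_range (fun i => pairWeight t q (toWord σ i)
      (toWord σ (i + 1))), ← prod_const, ← prod_pow_eq_pow_sum, prod_filter, ← prod_mul_distrib]
    refine prod_congr rfl fun i _ => ?_
    unfold pairWeight
    split_ifs with h
    · rfl
    · rw [Nat.sub_eq_zero_of_le (not_lt.mp h), pow_zero, mul_one]

/-! ### Symmetries carrying 231 to 213, 132 and 312 -/

theorem rdaNum_eq_zero_iff (σ : Equiv.Perm (Fin n)) :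
    rdaNum σ = 0 ↔ ∀ i j k : Fin n, (j : ℕ) = i + 1 → (k : ℕ) = j + 1 →
      ¬ (σ i < σ j ∧ σ j < σ k) := by
  rw [rdaNum, card_eq_zero, filter_eq_empty_iff]
  constructor
  · intro h i j k hj hk ⟨h1, h2⟩
    refine h (mem_Icc.mpr ⟨?_, j.isLt⟩ : (j : ℕ) + 1 ∈ Icc 1 n) ?_
    · omega
    have ei : padded σ ⊤ 0 j = ((σ i : ℕ) + 1 : ℕ) := by
      have : (⟨(j : ℕ) - 1, by omega⟩ : Fin n) = i := Fin.ext (by simp [hj])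
      simp only [padded]
      rw [if_neg (by omega), dif_pos (by omega), this]
    have ej : padded σ ⊤ 0 (j + 1) = ((σ j : ℕ) + 1 : ℕ) := by simp [padded]
    have ek : padded σ ⊤ 0 (j + 1 + 1) = ((σ k : ℕ) + 1 : ℕ) := by simp [padded, ← hk]
    rw [Nat.add_sub_cancel, ei, ej, ek, Nat.cast_lt, Nat.cast_lt]
    exact ⟨Nat.succ_lt_succ h1, Nat.succ_lt_succ h2⟩
  · rintro h m hm ⟨h1, h2⟩
    obtain ⟨hm1, hm2⟩ := mem_Icc.mp hm
    obtain ⟨m, rfl⟩ : ∃ m', m = m' + 1 := ⟨m - 1, by omega⟩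
    rw [Nat.add_sub_cancel] at h1
    have hm0 : m ≠ 0 := by rintro rfl; simp [padded] at h1
    have hmn : m + 1 < n := by
      by_contra hc
      have : padded σ ⊤ 0 (m + 1 + 1) = 0 := by simp [padded, hc]
      rw [this] at h2
      exact not_lt_zero h2
    have e0 : padded σ ⊤ 0 m = ((σ ⟨m - 1, by omega⟩ : ℕ) + 1 : ℕ) := by
      simp only [padded]
      rw [if_neg hm0, dif_pos (by omega)]
    have e1 : padded σ ⊤ 0 (m + 1) = ((σ ⟨m, by omega⟩ : ℕ) + 1 : ℕ) := by
      simp [padded, show m < n by omega]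
    have e2 : padded σ ⊤ 0 (m + 1 + 1) = ((σ ⟨m + 1, hmn⟩ : ℕ) + 1 : ℕ) := by simp [padded, hmn]
    rw [e0, e1, Nat.cast_lt] at h1
    rw [e1, e2, Nat.cast_lt] at h2
    exact h ⟨m - 1, by omega⟩ ⟨m, by omega⟩ ⟨m + 1, hmn⟩ (by
      simp only; omega) rfl
      ⟨Nat.lt_of_succ_lt_succ h1, Nat.lt_of_succ_lt_succ h2⟩

theorem succ_rev_iff (i j : Fin n) : (i.rev : ℕ) = j.rev + 1 ↔ (j : ℕ) = i + 1 := by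
  simp only [Fin.val_rev]
  have := i.isLt
  have := j.isLt
  omega

/-! ### Complement -/

theorem compl_avoids (σ : Equiv.Perm (Fin n)) :
    Avoids (Fin.revPerm * σ) ![2, 1, 3] ↔ Avoids σ ![2, 3, 1] := by
  simp [avoids_213_iff, avoids_231_iff, Equiv.Perm.mul_apply, and_comm]

theorem compl_rdaNum (σ : Equiv.Perm (Fin n)) :
    rdaNum (Fin.revPerm * σ) = 0 ↔ lddNum σ = 0 := by
  simp [rdaNum_eq_zero_iff, lddNum_eq_zero_iff, Equiv.Perm.mul_apply, and_comm]

theorem compl_ascNum (σ : Equiv.Perm (Fin n)) : ascNum (Fin.revPerm * σ) = desNum σ := by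
  simp [ascNum, desNum, Equiv.Perm.mul_apply]

theorem compl_v13_2 (σ : Equiv.Perm (Fin n)) : v13_2 (Fin.revPerm * σ) = v31_2 σ := by
  simp only [v13_2, v31_2, Equiv.Perm.mul_apply, Fin.revPerm_apply, Fin.rev_lt_rev]
  simp only [and_comm]

/-! ### Reversal -/

theorem reverse_avoids (σ : Equiv.Perm (Fin n)) :
    Avoids (σ * Fin.revPerm) ![1, 3, 2] ↔ Avoids σ ![2, 3, 1] := by
  simp only [avoids_132_iff, avoids_231_iff, Equiv.Perm.mul_apply, Fin.revPerm_apply]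
  constructor
  · intro h i j k hij hjk
    simpa [and_comm] using h k.rev j.rev i.rev (Fin.rev_lt_rev.mpr hjk) (Fin.rev_lt_rev.mpr hij)
  · intro h i j k hij hjk
    simpa [and_comm] using h k.rev j.rev i.rev (Fin.rev_lt_rev.mpr hjk) (Fin.rev_lt_rev.mpr hij)

theorem reverse_rdaNum (σ : Equiv.Perm (Fin n)) :
    rdaNum (σ * Fin.revPerm) = 0 ↔ lddNum σ = 0 := by
  simp only [rdaNum_eq_zero_iff, lddNum_eq_zero_iff, Equiv.Perm.mul_apply, Fin.revPerm_apply]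
  constructor
  · intro h i j k hij hjk
    simpa [and_comm] using h k.rev j.rev i.rev ((succ_rev_iff _ _).mpr hjk)
      ((succ_rev_iff _ _).mpr hij)
  · intro h i j k hij hjk
    simpa [and_comm] using h k.rev j.rev i.rev ((succ_rev_iff _ _).mpr hjk)
      ((succ_rev_iff _ _).mpr hij)

theorem reverse_ascNum (σ : Equiv.Perm (Fin n)) : ascNum (σ * Fin.revPerm) = desNum σ := by
  refine card_nbij' (fun p => (p.2.rev, p.1.rev)) (fun p => (p.2.rev, p.1.rev)) ?_ ?_ ?_ ?_
  · rintro ⟨i, j⟩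
    simp [succ_rev_iff, -Fin.val_rev, Equiv.Perm.mul_apply]
  · rintro ⟨i, j⟩
    simp [succ_rev_iff, -Fin.val_rev, Equiv.Perm.mul_apply]
  · rintro ⟨i, j⟩ _; simp
  · rintro ⟨i, j⟩ _; simp

theorem reverse_v2_13 (σ : Equiv.Perm (Fin n)) : v2_13 (σ * Fin.revPerm) = v31_2 σ := by
  refine card_nbij' (fun p => (p.2.1.rev, p.1.rev, p.2.2.rev))
    (fun p => (p.2.1.rev, p.1.rev, p.2.2.rev)) ?_ ?_ ?_ ?_
  · rintro ⟨i, j, k⟩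
    simp [succ_rev_iff, -Fin.val_rev, Equiv.Perm.mul_apply]
  · rintro ⟨i, j, k⟩
    simp [succ_rev_iff, -Fin.val_rev, Equiv.Perm.mul_apply]
  · rintro ⟨i, j⟩ _; simp
  · rintro ⟨i, j⟩ _; simp

/-! ### Reversed complement -/

theorem revCompl_avoids (σ : Equiv.Perm (Fin n)) :
    Avoids (Fin.revPerm * σ * Fin.revPerm) ![3, 1, 2] ↔ Avoids σ ![2, 3, 1] := by
  simp only [avoids_312_iff, avoids_231_iff, Equiv.Perm.mul_apply, Fin.revPerm_apply,
    Fin.rev_lt_rev]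
  constructor
  · intro h i j k hij hjk
    simpa [and_comm] using h k.rev j.rev i.rev (Fin.rev_lt_rev.mpr hjk) (Fin.rev_lt_rev.mpr hij)
  · intro h i j k hij hjk
    simpa [and_comm] using h k.rev j.rev i.rev (Fin.rev_lt_rev.mpr hjk) (Fin.rev_lt_rev.mpr hij)

theorem revCompl_lddNum (σ : Equiv.Perm (Fin n)) :
    lddNum (Fin.revPerm * σ * Fin.revPerm) = 0 ↔ lddNum σ = 0 := by
  simp only [lddNum_eq_zero_iff, Equiv.Perm.mul_apply, Fin.revPerm_apply, Fin.rev_lt_rev]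
  constructor
  · intro h i j k hij hjk
    simpa [and_comm] using h k.rev j.rev i.rev ((succ_rev_iff _ _).mpr hjk)
      ((succ_rev_iff _ _).mpr hij)
  · intro h i j k hij hjk
    simpa [and_comm] using h k.rev j.rev i.rev ((succ_rev_iff _ _).mpr hjk)
      ((succ_rev_iff _ _).mpr hij)

theorem revCompl_desNum (σ : Equiv.Perm (Fin n)) :
    desNum (Fin.revPerm * σ * Fin.revPerm) = desNum σ := by
  refine card_nbij' (fun p => (p.2.rev, p.1.rev)) (fun p => (p.2.rev, p.1.rev)) ?_ ?_ ?_ ?_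
  · rintro ⟨i, j⟩
    simp [succ_rev_iff, -Fin.val_rev, Equiv.Perm.mul_apply]
  · rintro ⟨i, j⟩
    simp [succ_rev_iff, -Fin.val_rev, Equiv.Perm.mul_apply]
  · rintro ⟨i, j⟩ _; simp
  · rintro ⟨i, j⟩ _; simp

theorem revCompl_v2_31 (σ : Equiv.Perm (Fin n)) :
    v2_31 (Fin.revPerm * σ * Fin.revPerm) = v31_2 σ := by
  refine card_nbij' (fun p => (p.2.1.rev, p.1.rev, p.2.2.rev))
    (fun p => (p.2.1.rev, p.1.rev, p.2.2.rev)) ?_ ?_ ?_ ?_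
  · rintro ⟨i, j, k⟩
    simpa [succ_rev_iff, -Fin.val_rev, Equiv.Perm.mul_apply] using fun a b c d => ⟨a, b, d, c⟩
  · rintro ⟨i, j, k⟩
    simpa [succ_rev_iff, -Fin.val_rev, Equiv.Perm.mul_apply] using fun a b c d => ⟨a, b, d, c⟩
  · rintro ⟨i, j⟩ _; simp
  · rintro ⟨i, j⟩ _; simp

theorem sum_tildeS213 {R : Type*} [CommSemiring R] (k : ℕ) (g : ℕ → R) :
    ∑ π ∈ tildeS213 n k, g (v13_2 π) = ∑ π ∈ tildeS231 n k, g (v31_2 π) := by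
  refine (sum_equiv (Equiv.mulLeft Fin.revPerm) (fun σ => ?_) fun σ _ => ?_).symm
  · simp [tildeS213, tildeS231, avoiders, compl_avoids, compl_rdaNum, compl_ascNum]
  · simp [compl_v13_2]

theorem sum_tildeS132 {R : Type*} [CommSemiring R] (k : ℕ) (g : ℕ → R) :
    ∑ π ∈ tildeS132 n k, g (v2_13 π) = ∑ π ∈ tildeS231 n k, g (v31_2 π) := by
  refine (sum_equiv (Equiv.mulRight Fin.revPerm) (fun σ => ?_) fun σ _ => ?_).symm
  · simp [tildeS132, tildeS231, avoiders, reverse_avoids, reverse_rdaNum, reverse_ascNum]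
  · simp [reverse_v2_13]

theorem sum_tildeS312 {R : Type*} [CommSemiring R] (k : ℕ) (g : ℕ → R) :
    ∑ π ∈ tildeS312 n k, g (v2_31 π) = ∑ π ∈ tildeS231 n k, g (v31_2 π) := by
  refine (sum_equiv ((Equiv.mulLeft Fin.revPerm).trans (Equiv.mulRight Fin.revPerm))
    (fun σ => ?_) fun σ _ => ?_).symm
  · simp [tildeS312, tildeS231, avoiders, revCompl_avoids, revCompl_lddNum, revCompl_desNum]
  · simp [revCompl_v2_31]

end

/-! ### The γ-coefficients -/

theorem coeff_sum_X_pow {R ι : Type*} [CommSemiring R] (s : Finset ι) (d e : ι → ℕ) (q : R)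
    (k : ℕ) : (∑ i ∈ s, (Polynomial.X : Polynomial R) ^ d i * Polynomial.C q ^ e i).coeff k =
      ∑ i ∈ s with d i = k, q ^ e i := by
  rw [Polynomial.finsetSum_coeff, sum_filter]
  refine sum_congr rfl fun i _ => ?_
  rw [← Polynomial.C_pow, Polynomial.coeff_mul_C, Polynomial.coeff_X_pow]
  simp [eq_comm]

/-- Both generating functions equal `pathSum X 1 1 (C q) m 0` over the polynomial ring; the identity
compares their coefficients of `X ^ j`. -/
theorem sum_tildeS321_inv {R : Type*} [CommSemiring R] (m j : ℕ) (q : R) :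
    ∑ π ∈ tildeS321 m j, q ^ invNum π = ∑ π ∈ tildeS231 m j, q ^ (v31_2 π + j) := by
  have h1 := sum_exc_inv_cda m (Polynomial.X : Polynomial R) 1 (Polynomial.C q)
  have h2 := sum_des_v31_2 m (Polynomial.X : Polynomial R) (Polynomial.C q)
  have h := congrArg (fun p => Polynomial.coeff p j) (h1.trans h2.symm)
  simp only [one_pow, mul_one, coeff_sum_X_pow, filter_filter] at h
  simp only [tildeS321, tildeS231, and_comm (b := _ = 0)]
  refine h.trans (sum_congr rfl fun π hπ => ?_)
  rw [(mem_filter.mp hπ).2.2]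

/-- Multiplying by `q ^ j` removes the truncated subtraction from the exponent; for `q ≠ 0` the
factor can be cancelled afterwards. -/
theorem gammaTilde_mul_pow {R : Type*} [CommSemiring R] (m j : ℕ) (q : R) :
    gammaTilde m j q * q ^ j = q ^ m * ∑ π ∈ tildeS321 m j, q ^ invNum π := by
  rw [gammaTilde, sum_mul, mul_sum]
  refine sum_congr rfl fun π hπ => ?_
  have h : excNum π = j := (mem_filter.mp hπ).2.1
  have := excNum_le π
  rw [← pow_add, ← pow_add]
  congr 1
  omega

theorem gammaTilde_eq_sum_tildeS231 {K : Type*} [Field K] (m j : ℕ) {q : K} (hq : q ≠ 0) :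
    gammaTilde m j q = ∑ π ∈ tildeS231 m j, q ^ (m + v31_2 π) := by
  refine mul_right_cancel₀ (pow_ne_zero j hq) ?_
  rw [gammaTilde_mul_pow, sum_tildeS321_inv, mul_sum, sum_mul]
  refine sum_congr rfl fun π _ => ?_
  ring

theorem narayana_eq_sum_wex {R : Type*} [CommSemiring R] (n : ℕ) (t q : R) :
    narayana n t q t = ∑ σ ∈ avoiders n ![3, 2, 1], t ^ wexNum σ * q ^ invNum σ := by
  refine sum_congr rfl fun σ _ => ?_
  have h : wexNum σ = excNum σ + fixNum σ := by
    rw [wexNum, excNum, fixNum, ← card_union_of_disjoint, ← filter_or]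
    · simp only [le_iff_lt_or_eq, eq_comm]
    · rw [disjoint_left]
      intro i hi hi'
      exact (mem_filter.mp hi).2.ne' (mem_filter.mp hi').2
  rw [h]
  ring

theorem two_mul_excNum_le {n : ℕ} {σ : Equiv.Perm (Fin n)} (h : cdaNum σ = 0) :
    2 * excNum σ ≤ n := by
  have := card_rest h
  omega

theorem pathSum_eq_sum_gammaTilde {K : Type*} [Field K] (m : ℕ) (t : K) {q : K} (hq : q ≠ 0) :
    pathSum (t * q) (t + q) (t + q) q m 0 =
      ∑ j ∈ range (m / 2 + 1), gammaTilde m j q * t ^ j * (1 + t / q) ^ (m - 2 * j) := by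
  rw [← sum_exc_inv_cda, ← sum_fiberwise_of_maps_to (t := range (m / 2 + 1)) (g := excNum)]
  · refine sum_congr rfl fun j hj => ?_
    have hj := mem_range.mp hj
    rw [gammaTilde, sum_mul, sum_mul, filter_filter]
    simp only [tildeS321, and_comm]
    refine sum_congr rfl fun σ hσ => ?_
    obtain ⟨h1, h2⟩ := (mem_filter.mp hσ).2
    have e1 : t + q = q * (1 + t / q) := by field_simp; ring
    -- The powers of `q` come from the up weights `t * q`, the level weights `q * (1 + t / q)`, and
    -- the heights. The identity holds because `2 * excNum σ ≤ m`.
    have e2 : m + invNum σ - excNum σ = excNum σ + (m - 2 * excNum σ) + invNum σ := by omega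
    rw [e2, h2, e1, mul_pow, mul_pow]
    ring
  · intro σ hσ
    have := two_mul_excNum_le (mem_filter.mp hσ).2
    rw [mem_range]
    omega

end QNarayana

open QNarayana
theorem mainTheorem9 {K : Type*} [Field K] (n : ℕ) (hn : 1 ≤ n) (t q : K) (hq : q ≠ 0) :
    narayana n t q t = ∑ σ ∈ avoiders n ![3, 2, 1], t ^ wexNum σ * q ^ invNum σ ∧
    narayana n t q t =
      ∑ k ∈ Finset.Icc 1 ((n + 1) / 2),
        gammaTilde (n - 1) (k - 1) q * t ^ k * (1 + t / q) ^ (n + 1 - 2 * k) ∧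
    ∀ k : ℕ, 1 ≤ k →
      gammaTilde (n - 1) (k - 1) q = ∑ π ∈ tildeS231 (n - 1) (k - 1), q ^ (n - 1 + v31_2 π) ∧
      gammaTilde (n - 1) (k - 1) q = ∑ π ∈ tildeS312 (n - 1) (k - 1), q ^ (n - 1 + v2_31 π) ∧
      gammaTilde (n - 1) (k - 1) q = ∑ π ∈ tildeS132 (n - 1) (k - 1), q ^ (n - 1 + v2_13 π) ∧
      gammaTilde (n - 1) (k - 1) q = ∑ π ∈ tildeS213 (n - 1) (k - 1), q ^ (n - 1 + v13_2 π) := by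
  obtain ⟨m, rfl⟩ : ∃ m, n = m + 1 := ⟨n - 1, by omega⟩
  rw [Nat.add_sub_cancel]
  refine ⟨narayana_eq_sum_wex _ t q, ?_, fun k _ => ?_⟩
  -- The index shift is `k = 1 + j`; the factor `t` split off by `pathSum_succ_zero` turns `t ^ j`
  -- into `t ^ k`.
  · rw [narayana_eq_sum_wex, sum_wex_inv, pathSum_succ_zero, pathSum_eq_sum_gammaTilde m t hq,
      mul_sum, ← Finset.Ico_add_one_right_eq_Icc, sum_Ico_eq_sum_range,
      show (m + 1 + 1) / 2 + 1 - 1 = m / 2 + 1 by omega]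
    refine sum_congr rfl fun j _ => ?_
    rw [Nat.add_sub_cancel_left, show m + 1 + 1 - 2 * (1 + j) = m - 2 * j by omega]
    ring
  · have h := gammaTilde_eq_sum_tildeS231 m (k - 1) hq
    refine ⟨h, ?_, ?_, ?_⟩
    · rw [h, sum_tildeS312 (k - 1) (fun x => q ^ (m + x))]
    · rw [h, sum_tildeS132 (k - 1) (fun x => q ^ (m + x))]
    · rw [h, sum_tildeS213 (k - 1) (fun x => q ^ (m + x))]
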